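/- Let $G$ be a finite simple graph and let $\Phi=(G,\varphi)$ be a complex unit gain graph on $G$: $\varphi$ assigns to every oriented edge $uv$ a complex number $\varphi(uv)$ with $|\varphi(uv)|=1$, and $\varphi(vu)=\varphi(uv)^{-1}$. Let $r(\Phi)$ be the rank of the matrix $A(\Phi)$ whose $(u,v)$ entry is $\varphi(uv)$ if $u,v$ are adjacent and $0$ otherwise, let $r(G)$ be the rank of the adjacency matrix of $G$, and let $\theta(G)=|E(G)|-|V(G)|+\omega(G)$, where $\omega(G)$ is the number of connected components of $G$. The gain of a cycle $v_1v_2\cdots v_pv_1$ is $\varphi(v_1v_2)\varphi(v_2v_3)\cdots\varphi(v_pv_1)$; the cycle is of Type B if $p$ is even and its gain is not $(-1)^{p/2}$ (this does not depend on the starting vertex or the direction). A $\delta$-transformation deletes from a graph a vertex of degree $1$ together with its neighbour. A crucial subgraph of $G$ is an induced subgraph without vertices of degree $1$ that is obtained from $G$ by a finite (possibly empty) sequence of $\delta$-transformations. Then $r(\Phi)=r(G)+2\theta(G)$ if and only if all of the following hold: (i) distinct cycles of $G$ (if any) have no common vertices; (ii) every cycle of $\Phi$ is of Type B and has length $p\equiv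 0\pmod 4$; (iii) $G$ has a crucial subgraph $G_0$ that is the disjoint union of $\theta(G)$ cycles together with some (possibly no) isolated vertices. -/

import Mathlib

open SimpleGraph

noncomputable section

/-- A `𝕋`-gain function on a simple graph: every oriented edge carries a unit complex number, and
reversing the orientation inverts it. A pair `(G, φ)` is a complex unit gain graph. -/
structure GainFunction {V : Type*} (G : SimpleGraph V) where
  gain : G.Dart → Circle
  gain_symm : ∀ d : G.Dart, gain d.symm = (gain d)⁻¹

namespace GainFunction

variable {V : Type*} {G : SimpleGraph V}

open Classical in
/-- The adjacency matrix of the gain graph `(G, φ)`. -/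
def adjMatrix (φ : GainFunction G) : Matrix V V ℂ :=
  Matrix.of fun u v => if h : G.Adj u v then (φ.gain ⟨(u, v), h⟩ : ℂ) else 0

/-- The rank of the gain graph `(G, φ)`. -/
def rank [Fintype V] (φ : GainFunction G) : ℕ := φ.adjMatrix.rank

/-- The gain of a walk: the product of the gains of its successive oriented edges. -/
def walkGain (φ : GainFunction G) {u v : V} (w : G.Walk u v) : ℂ :=
  (w.darts.map fun d => (φ.gain d : ℂ)).prod

/-- A cycle, given by a closed walk around it, is of Type B if its order `n` is even and its gain
is not `(-1) ^ (n / 2)`. Since `(-1) ^ (n / 2)` is its own inverse, this depends neither on the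
starting point nor on the direction. -/
def IsTypeB (φ : GainFunction G) {u : V} (c : G.Walk u u) : Prop :=
  Even c.length ∧ φ.walkGain c ≠ (-1) ^ (c.length / 2)

end GainFunction

namespace SimpleGraph

variable {V : Type*} (G : SimpleGraph V)

open Classical in
/-- The rank of a graph: the rank of its adjacency matrix. -/
def adjRank [Fintype V] : ℕ := (G.adjMatrix ℂ).rank

/-- The dimension of the cycle space, `θ(G) = |E(G)| - |V(G)| + ω(G)` (for finite `V`). -/
def cycleDim : ℤ :=
  (G.edgeSet.ncard : ℤ) - (Nat.card V : ℤ) + (Nat.card G.ConnectedComponent : ℤ)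

variable {G} in
/-- The subgraph `C` of `G` is a cycle. -/
def Subgraph.IsCycleGraph (C : G.Subgraph) : Prop :=
  ∃ (u : V) (c : G.Walk u u), c.IsCycle ∧ c.toSubgraph = C

/-- Distinct cycles of `G` have no common vertices. -/
def CyclesVertexDisjoint : Prop :=
  ∀ C D : G.Subgraph, C.IsCycleGraph → D.IsCycleGraph → C ≠ D → Disjoint C.verts D.verts

/-- A pendant vertex: a vertex of degree one. -/
def IsPendant (v : V) : Prop := (G.neighborSet v).ncard = 1

/-- A `δ`-transformation from the induced subgraph `G[S]` to the induced subgraph `G[S']`: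
a pendant vertex `u` of `G[S]` and its neighbour `v` are deleted. -/
def DeltaStep (S S' : Set V) : Prop :=
  ∃ u v : S, (G.induce S).IsPendant u ∧ (G.induce S).Adj u v ∧ S' = S \ {(u : V), (v : V)}

/-- `G[S]` is a crucial subgraph of `G`: it has no pendant vertices and is obtained from `G` by a
(finite, possibly empty) series of `δ`-transformations. -/
def IsCrucial (S : Set V) : Prop :=
  Relation.ReflTransGen G.DeltaStep Set.univ S ∧ ∀ v : S, ¬ (G.induce S).IsPendant v

variable {G} in
/-- The connected component `K` of `G` is a cycle. -/
def ConnectedComponent.IsCycleComponent (K : G.ConnectedComponent) : Prop :=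
  ((⊤ : G.Subgraph).induce K.supp).IsCycleGraph

/-- `G` is the disjoint union of `k` cycles together with some (possibly no) isolated vertices:
each component is a cycle or a single vertex, and exactly `k` of them are cycles. -/
def IsDisjointUnionOfCycles (k : ℤ) : Prop :=
  (∀ K : G.ConnectedComponent, K.IsCycleComponent ∨ ∃ v, K.supp = {v}) ∧
    ({K : G.ConnectedComponent | K.IsCycleComponent}.ncard : ℤ) = k

end SimpleGraph

end

/-! The inequality r(Φ) ≤ r(G) + 2θ(G) comes from two reductions. Deleting a vertex on a cycle
lowers r(Φ) by at most 2, does not raise r(G), and lowers θ by at least 1. A δ-transformation lowers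
both ranks by exactly 2 and does not raise θ. A graph to which neither applies has no edges.

In the case of equality (`IsExtremal`) every one of these estimates is sharp. Deleting a cyclic
vertex then costs exactly 1 in θ, which forces distinct cycles to be disjoint. The neighbour of a
pendant vertex is never cyclic, so δ-transformations preserve both extremality and θ. Peeling
everything off a given cycle leaves a graph with that cycle as its only edges, where comparing
nullities gives Type B and 4 ∣ p.

The main point is that an extremal graph without pendant vertices has no bridge
(`IsExtremal.not_isBridge`). If a bridge left a cycle at u, deleting one vertex from each of
suitable disjoint cycles would keep r(G). So some kernel vector of the adjacency matrix equals 1 at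
u and 0 at the other chosen vertices. Working inwards from the far ends, the kernel equations force
it to vanish at u. Hence the components of a crucial subgraph are cycles and isolated vertices.

On such a disjoint union each good cycle is nonsingular for Φ and has nullity 2 for G, so the ranks
differ by twice the number of cycles. This identifies that number with θ(G), and gives the converse
because δ-transformations preserve r(Φ) - r(G).

Deletion is modelled by `restr`, which isolates the deleted vertices, so all matrices keep the index
type V; isolated vertices affect neither rank nor θ. -/

namespace SimpleGraph

/-! ### The cycle space dimension under deletions. -/

variable {V : Type*} {G H : SimpleGraph V}

/-- The graph on the same vertex set keeping only the edges inside `S`. -/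
def restr (G : SimpleGraph V) (S : Set V) : SimpleGraph V where
  Adj u v := u ∈ S ∧ v ∈ S ∧ G.Adj u v
  symm := ⟨fun _ _ h => ⟨h.2.1, h.1, h.2.2.symm⟩⟩
  loopless := ⟨fun _ h => G.irrefl h.2.2⟩

theorem restr_adj {S : Set V} {u v : V} : (G.restr S).Adj u v ↔ u ∈ S ∧ v ∈ S ∧ G.Adj u v := Iff.rfl

theorem restr_le (G : SimpleGraph V) (S : Set V) : G.restr S ≤ G := fun _ _ h => h.2.2

theorem restr_univ (G : SimpleGraph V) : G.restr Set.univ = G := by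
  ext; simp [restr_adj]

theorem ncard_edgeSet_lt_of_lt [Finite V] (h : H < G) : H.edgeSet.ncard < G.edgeSet.ncard :=
  Set.ncard_lt_ncard (edgeSet_strict_mono h) (Set.toFinite _)

theorem restr_lt_of_adj {S : Set V} {u v : V} (h : G.Adj u v) (hu : u ∉ S) : G.restr S < G :=
  lt_of_le_of_ne (restr_le G S) fun e =>
    hu (show (G.restr S).Adj u v by rw [e]; exact h).1

theorem ncard_edgeSet_deleteEdges [Finite V] {u v : V} (h : G.Adj u v) :
    (G.deleteEdges {s(u, v)}).edgeSet.ncard + 1 = G.edgeSet.ncard := by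
  rw [edgeSet_deleteEdges]
  exact Set.ncard_sdiff_singleton_add_one (s := G.edgeSet) h (Set.toFinite _)

theorem reachable_deleteEdges_of_not_isBridge {u v x y : V} (hb : ¬ G.IsBridge s(u, v))
    (h : G.Reachable x y) : (G.deleteEdges {s(u, v)}).Reachable x y := by
  rw [isBridge_iff, not_not] at hb
  obtain ⟨w⟩ := h
  induction w with
  | nil => exact Reachable.refl _
  | @cons a b c hab _ ih =>
    refine Reachable.trans ?_ ih
    by_cases he : s(a, b) = s(u, v)
    · rcases Sym2.eq_iff.1 he with ⟨rfl, rfl⟩ | ⟨rfl, rfl⟩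
      · exact hb
      · exact hb.symm
    · exact Adj.reachable (by simp [deleteEdges_adj, hab, he])

theorem card_connectedComponent_deleteEdges_of_not_isBridge {u v : V}
    (hb : ¬ G.IsBridge s(u, v)) :
    Nat.card (G.deleteEdges {s(u, v)}).ConnectedComponent = Nat.card G.ConnectedComponent := by
  apply Nat.card_congr
  refine Quot.congr (Equiv.refl V) fun a b => ⟨fun h => h.mono (deleteEdges_le _), fun h => ?_⟩
  exact reachable_deleteEdges_of_not_isBridge hb h

theorem card_connectedComponent_deleteEdges_of_isBridge [Finite V] {u v : V} (h : G.Adj u v)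
    (hb : G.IsBridge s(u, v)) :
    Nat.card (G.deleteEdges {s(u, v)}).ConnectedComponent = Nat.card G.ConnectedComponent + 1 := by
  classical
  rw [isBridge_iff] at hb
  set H := G.deleteEdges {s(u, v)} with hH
  have hadj : ∀ a b, G.Adj a b → s(a, b) ≠ s(u, v) → H.Adj a b := fun a b hab hne => by
    simp [hH, deleteEdges_adj, hab, hne]
  -- Deleting the bridge splits one component in two. Sending the side of u to the component of v
  -- identifies the old components with the new ones other than that of u.
  let f : V → {K : H.ConnectedComponent // K ≠ H.connectedComponentMk u} := fun w =>
    if hw : H.Reachable w u then ⟨H.connectedComponentMk v, fun e =>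
      hb (ConnectedComponent.exact e).symm⟩
    else ⟨H.connectedComponentMk w, fun e => hw (ConnectedComponent.exact e)⟩
  have hfu : ∀ w, H.Reachable w u → (f w).1 = H.connectedComponentMk v := fun w hw => by
    simp only [f, dif_pos hw]
  have hfn : ∀ w, ¬ H.Reachable w u → (f w).1 = H.connectedComponentMk w := fun w hw => by
    simp only [f, dif_neg hw]
  have hfe : ∀ a b, H.Reachable a b → f a = f b := fun a b hab => by
    by_cases ha : H.Reachable a u
    · exact Subtype.ext ((hfu a ha).trans (hfu b (hab.symm.trans ha)).symm)
    · refine Subtype.ext ((hfn a ha).trans ?_)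
      rw [hfn b fun hb' => ha (hab.trans hb')]
      exact ConnectedComponent.sound hab
  have hfuv : f u = f v := Subtype.ext ((hfu u (Reachable.refl _)).trans
    (hfn v fun e => hb e.symm).symm)
  have hfG : ∀ a b, G.Adj a b → f a = f b := fun a b hab => by
    by_cases he : s(a, b) = s(u, v)
    · rcases Sym2.eq_iff.1 he with ⟨rfl, rfl⟩ | ⟨rfl, rfl⟩
      · exact hfuv
      · exact hfuv.symm
    · exact hfe a b (hadj a b hab he).reachable
  have hfR : ∀ a b, G.Reachable a b → f a = f b := by
    rintro a b ⟨w⟩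
    induction w with
    | nil => rfl
    | cons hab _ ih => exact (hfG _ _ hab).trans ih
  let F : G.ConnectedComponent → {K : H.ConnectedComponent // K ≠ H.connectedComponentMk u} :=
    Quot.lift f hfR
  have hF : Function.Bijective F := by
    constructor
    · intro K L
      refine K.ind fun a => L.ind fun b => ?_
      intro hab
      have hab : (f a).1 = (f b).1 := congrArg Subtype.val hab
      apply ConnectedComponent.sound
      have key : ∀ w, ∃ w', G.Reachable w w' ∧ (f w).1 = H.connectedComponentMk w' := fun w => by
        by_cases hw : H.Reachable w u
        · exact ⟨v, (hw.mono (deleteEdges_le _)).trans h.reachable, hfu w hw⟩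
        · exact ⟨w, Reachable.refl _, hfn w hw⟩
      obtain ⟨a', ha, ha'⟩ := key a
      obtain ⟨b', hb', hb''⟩ := key b
      rw [ha', hb''] at hab
      exact ha.trans (((ConnectedComponent.exact hab).mono (deleteEdges_le _)).trans hb'.symm)
    · rintro ⟨K, hK⟩
      induction K using ConnectedComponent.ind with
      | h w =>
        refine ⟨G.connectedComponentMk w, Subtype.ext ?_⟩
        exact hfn w fun e => hK (ConnectedComponent.sound e)
  rw [Nat.card_congr (Equiv.ofBijective F hF)]
  have := Nat.card_congr (Equiv.optionSubtypeNe (H.connectedComponentMk u))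
  rw [← this, Finite.card_option]

theorem cycleDim_deleteEdges_of_not_isBridge [Finite V] {u v : V} (h : G.Adj u v)
    (hb : ¬ G.IsBridge s(u, v)) : (G.deleteEdges {s(u, v)}).cycleDim + 1 = G.cycleDim := by
  have h1 := ncard_edgeSet_deleteEdges h
  have h2 := card_connectedComponent_deleteEdges_of_not_isBridge hb
  unfold cycleDim; omega

theorem cycleDim_deleteEdges_of_isBridge [Finite V] {u v : V} (h : G.Adj u v)
    (hb : G.IsBridge s(u, v)) : (G.deleteEdges {s(u, v)}).cycleDim = G.cycleDim := by
  have h1 := ncard_edgeSet_deleteEdges h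
  have h2 := card_connectedComponent_deleteEdges_of_isBridge h hb
  unfold cycleDim; omega

theorem cycleDim_bot [Finite V] : (⊥ : SimpleGraph V).cycleDim = 0 := by
  have : Nat.card (⊥ : SimpleGraph V).ConnectedComponent = Nat.card V := by
    refine (Nat.card_congr (Equiv.ofBijective (⊥ : SimpleGraph V).connectedComponentMk
      ⟨fun a b hab => ?_, fun K => K.ind fun a => ⟨a, rfl⟩⟩)).symm
    simpa using ConnectedComponent.exact hab
  unfold cycleDim
  rw [this]; simp

theorem exists_adj_not_adj_of_lt (h : H < G) : ∃ u v, G.Adj u v ∧ ¬ H.Adj u v := by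
  by_contra! hc
  exact h.not_ge fun u v huv => hc u v huv

theorem le_deleteEdges {u v : V} (hle : H ≤ G) (h : ¬ H.Adj u v) :
    H ≤ G.deleteEdges {s(u, v)} := fun a b hab => by
  simp only [deleteEdges_adj, Set.mem_singleton_iff]
  refine ⟨hle hab, fun he => h ?_⟩
  rw [← mem_edgeSet, ← he]; exact hab

theorem cycleDim_deleteEdges_le [Finite V] {u v : V} (h : G.Adj u v) :
    (G.deleteEdges {s(u, v)}).cycleDim ≤ G.cycleDim := by
  by_cases hb : G.IsBridge s(u, v)
  · exact (cycleDim_deleteEdges_of_isBridge h hb).le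
  · have := cycleDim_deleteEdges_of_not_isBridge h hb; omega

theorem deleteEdges_lt {u v : V} (h : G.Adj u v) : G.deleteEdges {s(u, v)} < G :=
  lt_of_le_of_ne (deleteEdges_le _) fun e => by
    have : (G.deleteEdges {s(u, v)}).Adj u v := by rw [e]; exact h
    simp [deleteEdges_adj] at this

theorem cycleDim_mono [Finite V] (hle : H ≤ G) : H.cycleDim ≤ G.cycleDim := by
  induction hn : G.edgeSet.ncard using Nat.strong_induction_on generalizing G with
  | _ n ih =>
    rcases hle.eq_or_lt with rfl | hlt
    · exact le_rfl
    obtain ⟨u, v, huv, hnot⟩ := exists_adj_not_adj_of_lt hlt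
    exact (ih _ (hn ▸ ncard_edgeSet_lt_of_lt (deleteEdges_lt huv)) (le_deleteEdges hle hnot)
      rfl).trans (cycleDim_deleteEdges_le huv)

theorem cycleDim_nonneg [Finite V] : 0 ≤ G.cycleDim :=
  cycleDim_bot.symm.le.trans (cycleDim_mono bot_le)

/-- The missing edges can be removed one at a time, because a bridge remains a bridge in every
subgraph. -/
theorem cycleDim_eq_of_forall_isBridge [Finite V] (hle : H ≤ G)
    (hb : ∀ u v, G.Adj u v → ¬ H.Adj u v → G.IsBridge s(u, v)) : H.cycleDim = G.cycleDim := by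
  induction hn : G.edgeSet.ncard using Nat.strong_induction_on generalizing G with
  | _ n ih =>
    rcases hle.eq_or_lt with rfl | hlt
    · rfl
    obtain ⟨u, v, huv, hnot⟩ := exists_adj_not_adj_of_lt hlt
    rw [← cycleDim_deleteEdges_of_isBridge huv (hb u v huv hnot)]
    refine ih _ (hn ▸ ncard_edgeSet_lt_of_lt (deleteEdges_lt huv)) (le_deleteEdges hle hnot)
      (fun a b hab hnab => ?_) rfl
    exact (hb a b (deleteEdges_le _ hab) hnab).anti (deleteEdges_le _)

/-- The vertex `x` lies on a cycle. -/
def IsCyclic (G : SimpleGraph V) (x : V) : Prop := ∃ c : G.Walk x x, c.IsCycle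

theorem isCyclic_of_mem_support {u x : V} {c : G.Walk u u} (hc : c.IsCycle) (hx : x ∈ c.support) :
    G.IsCyclic x := by
  classical exact ⟨c.rotate x hx, hc.rotate hx⟩

theorem isCyclic_of_not_isBridge {u v : V} (h : G.Adj u v) (hb : ¬ G.IsBridge s(u, v)) :
    G.IsCyclic u := by
  rw [isBridge_iff_forall_cycle_notMem h] at hb
  push Not at hb
  obtain ⟨w, c, hc, he⟩ := hb
  exact isCyclic_of_mem_support hc (c.fst_mem_support_of_mem_edges he)

theorem IsCyclic.mono {x : V} (hle : H ≤ G) : H.IsCyclic x → G.IsCyclic x :=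
  fun ⟨c, hc⟩ => ⟨c.mapLe hle, hc.mapLe hle⟩

/-- A cycle edge at x is not a bridge, so removing it alone already costs 1; removing the other
edges at x cannot raise θ. -/
theorem cycleDim_restr_compl_singleton_lt [Finite V] {x : V} (hx : G.IsCyclic x) :
    (G.restr {x}ᶜ).cycleDim + 1 ≤ G.cycleDim := by
  obtain ⟨c, hc⟩ := hx
  have hadj : G.Adj x c.snd := c.adj_snd hc.not_nil
  have hmem : s(x, c.snd) ∈ c.edges := c.mk_start_snd_mem_edges hc.not_nil
  have hb : ¬ G.IsBridge s(x, c.snd) := fun hb => hb.notMem_edges_of_isCycle hc hmem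
  rw [← cycleDim_deleteEdges_of_not_isBridge hadj hb]
  have := cycleDim_mono (le_deleteEdges (restr_le G {x}ᶜ) (u := x) (v := c.snd)
    fun h => h.1 rfl)
  omega

/-- Removing the edge xy of d costs 1 and leaves c intact, so x is still cyclic and its deletion
costs 1 more. In the extremal case this excludes intersecting cycles. -/
theorem cycleDim_restr_compl_singleton_lt_of_two_cycles [Finite V] {x y u v : V} {c : G.Walk u u}
    {d : G.Walk v v} (hc : c.IsCycle) (hd : d.IsCycle) (hx : x ∈ c.support)
    (he : s(x, y) ∈ d.edges) (hne : s(x, y) ∉ c.edges) :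
    (G.restr {x}ᶜ).cycleDim + 2 ≤ G.cycleDim := by
  have hadj : G.Adj x y := d.adj_of_mem_edges he
  have hb : ¬ G.IsBridge s(x, y) := fun hb => hb.notMem_edges_of_isCycle hd he
  rw [← cycleDim_deleteEdges_of_not_isBridge hadj hb]
  have hq : ∀ e ∈ c.edges, e ∈ (G.deleteEdges {s(x, y)}).edgeSet := fun e hec => by
    rw [edgeSet_deleteEdges]
    exact ⟨c.edges_subset_edgeSet hec, fun h => hne (h ▸ hec)⟩
  have hcyc : (G.deleteEdges {s(x, y)}).IsCyclic x :=
    isCyclic_of_mem_support (hc.transfer hq) (by simpa using hx)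
  have h1 := cycleDim_restr_compl_singleton_lt hcyc
  have h2 : (G.restr {x}ᶜ).cycleDim ≤ ((G.deleteEdges {s(x, y)}).restr {x}ᶜ).cycleDim := by
    refine cycleDim_mono fun a b hab => ⟨hab.1, hab.2.1, ?_⟩
    exact le_deleteEdges (restr_le G {x}ᶜ) (fun h => h.1 rfl) hab
  omega

theorem cycleDim_restr_compl_pair [Finite V] {u v : V} (hu : ¬ G.IsCyclic u)
    (hv : ¬ G.IsCyclic v) : (G.restr {u, v}ᶜ).cycleDim = G.cycleDim := by
  refine cycleDim_eq_of_forall_isBridge (restr_le _ _) fun a b hab hnot => ?_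
  by_contra hb
  have ha := isCyclic_of_not_isBridge hab hb
  have hb' := isCyclic_of_not_isBridge hab.symm (by rwa [Sym2.eq_swap])
  have key : ∀ t, G.IsCyclic t → t ∈ ({u, v}ᶜ : Set V) := by
    rintro t ht (rfl | rfl)
    · exact hu ht
    · exact hv ht
  exact hnot ⟨key a ha, key b hb', hab⟩

theorem not_isCyclic_of_isPendant {u : V} (h : G.IsPendant u) : ¬ G.IsCyclic u := by
  rintro ⟨c, hc⟩
  have h2 := hc.ncard_neighborSet_toSubgraph_eq_two c.start_mem_support
  have hsub : c.toSubgraph.neighborSet u ⊆ G.neighborSet u := Subgraph.neighborSet_subset _ _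
  have := Set.ncard_le_ncard hsub (Set.finite_of_ncard_ne_zero (by rw [h]; exact one_ne_zero))
  rw [h2, h] at this
  omega

end SimpleGraph

/-! ### Ranks of restricted matrices and kernel estimates. -/

namespace Matrix

variable {V : Type*}

open Classical in
/-- The matrix obtained by replacing the entries outside `S × S` by zero. -/
noncomputable def restr (A : Matrix V V ℂ) (S : Set V) : Matrix V V ℂ :=
  Matrix.of fun u v => if u ∈ S ∧ v ∈ S then A u v else 0

open Classical in
/-- The coordinate projection onto `S`. -/
noncomputable def coordProj (S : Set V) : Matrix V V ℂ := Matrix.diagonal (S.indicator 1)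

theorem restr_apply_of_mem {A : Matrix V V ℂ} {S : Set V} {u v : V} (hu : u ∈ S) (hv : v ∈ S) :
    A.restr S u v = A u v := by simp [restr, hu, hv]

theorem restr_apply_of_notMem_left {A : Matrix V V ℂ} {S : Set V} {u v : V} (hu : u ∉ S) :
    A.restr S u v = 0 := by simp [restr, hu]

theorem restr_apply_of_notMem_right {A : Matrix V V ℂ} {S : Set V} {u v : V} (hv : v ∉ S) :
    A.restr S u v = 0 := by simp [restr, hv]

variable [Fintype V]

theorem restr_eq_mul (A : Matrix V V ℂ) (S : Set V) :
    A.restr S = coordProj S * (A * coordProj S) := by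
  classical
  ext u v
  simp only [coordProj, Matrix.diagonal_mul, Matrix.mul_diagonal, restr, Matrix.of_apply,
    Set.indicator_apply, Pi.one_apply]
  by_cases hu : u ∈ S <;> by_cases hv : v ∈ S <;> simp [hu, hv]

theorem rank_restr_le (A : Matrix V V ℂ) (S : Set V) : (A.restr S).rank ≤ A.rank := by
  rw [restr_eq_mul]
  exact (rank_mul_le_right _ _).trans (rank_mul_le_left _ _)

theorem rank_add_le (A B : Matrix V V ℂ) : (A + B).rank ≤ A.rank + B.rank := by
  unfold rank
  rw [Matrix.mulVecLin_add]
  refine (Submodule.finrank_mono ?_).trans (Submodule.finrank_add_le_finrank_add_finrank _ _)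
  rintro _ ⟨x, rfl⟩
  exact Submodule.add_mem_sup ⟨x, rfl⟩ ⟨x, rfl⟩

/-- Row x, and column x without its diagonal entry, each contribute a matrix of rank at most 1. -/
theorem rank_le_rank_restr_add_two (A : Matrix V V ℂ) (x : V) :
    A.rank ≤ (A.restr {x}ᶜ).rank + 2 := by
  classical
  have h : A = A.restr {x}ᶜ + (vecMulVec (Pi.single x 1) (A x) +
      vecMulVec (fun u => if u = x then 0 else A u x) (Pi.single x 1)) := by
    ext u v
    simp only [add_apply, vecMulVec_apply]
    by_cases hu : u = x
    · subst hu; simp [restr]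
    · by_cases hv : v = x
      · subst hv; simp [restr, hu]
      · simp [restr, hu, hv]
  calc A.rank = _ := congrArg rank h
    _ ≤ _ := (rank_add_le _ _).trans (Nat.add_le_add_left ((rank_add_le _ _).trans
        (Nat.add_le_add (rank_vecMulVec_le _ _) (rank_vecMulVec_le _ _))) _)

theorem rank_add_finrank_ker (A : Matrix V V ℂ) :
    A.rank + Module.finrank ℂ (LinearMap.ker A.mulVecLin) = Fintype.card V := by
  rw [rank, LinearMap.finrank_range_add_finrank_ker, Module.finrank_pi]

/-- Upper bound: once v is deleted, row and column u are already zero. Lower bound: a kernel vector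
of A vanishes at v, so it stays in the kernel after deletion, where the unit vectors at u and v add
two new dimensions. -/
theorem rank_eq_of_pendant {A : Matrix V V ℂ} {u v : V} (huv : u ≠ v) (h1 : A u v ≠ 0)
    (h2 : A v u ≠ 0) (hr : ∀ w, w ≠ v → A u w = 0) (hc : ∀ w, w ≠ v → A w u = 0) :
    A.rank = (A.restr {u, v}ᶜ).rank + 2 := by
  classical
  apply le_antisymm
  · have e : A.restr {u, v}ᶜ = A.restr {v}ᶜ := by
      ext a b
      by_cases ha : a = v
      · rw [restr_apply_of_notMem_left (by simp [ha]), restr_apply_of_notMem_left (by simp [ha])]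
      by_cases hb : b = v
      · rw [restr_apply_of_notMem_right (by simp [hb]), restr_apply_of_notMem_right (by simp [hb])]
      by_cases hau : a = u
      · rw [restr_apply_of_notMem_left (by simp [hau]), restr_apply_of_mem (by simpa) (by simpa),
          hau, hr b hb]
      by_cases hbu : b = u
      · rw [restr_apply_of_notMem_right (by simp [hbu]), restr_apply_of_mem (by simpa) (by simpa),
          hbu, hc a ha]
      rw [restr_apply_of_mem (by simp [*]) (by simp [*]),
        restr_apply_of_mem (by simp [*]) (by simp [*])]
    rw [e]
    exact rank_le_rank_restr_add_two A v
  · have k1 := rank_add_finrank_ker A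
    have k2 := rank_add_finrank_ker (A.restr {u, v}ᶜ)
    suffices h : Module.finrank ℂ (LinearMap.ker A.mulVecLin) + 2 ≤
        Module.finrank ℂ (LinearMap.ker (A.restr {u, v}ᶜ).mulVecLin) by omega
    have hzv : ∀ z, A *ᵥ z = 0 → z v = 0 := fun z hz => by
      have := congrFun hz u
      rw [mulVec, dotProduct, Finset.sum_eq_single v (fun w _ hw => by rw [hr w hw, zero_mul])
        (by simp)] at this
      simpa [h1] using this
    set W : Submodule ℂ (V → ℂ) := Submodule.span ℂ (Set.range
      ![(Pi.single u 1 : V → ℂ), Pi.single v 1]) with hW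
    have hWf : Module.finrank ℂ W = 2 := by
      have hli : LinearIndependent ℂ ![(Pi.single u 1 : V → ℂ), Pi.single v 1] := by
        rw [LinearIndependent.pair_iff]
        intro s t hst
        have hu := congrFun hst u
        have hv := congrFun hst v
        simp [huv, huv.symm] at hu hv
        exact ⟨hu, hv⟩
      rw [finrank_span_eq_card hli]; simp
    have hdisj : Disjoint (LinearMap.ker A.mulVecLin) W := by
      rw [Submodule.disjoint_def]
      intro z hz hzW
      rw [LinearMap.mem_ker, mulVecLin_apply] at hz
      have hzv' := hzv z hz
      rw [hW, Matrix.range_cons, Matrix.range_cons, Matrix.range_empty, Set.union_empty,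
        Set.singleton_union, Submodule.mem_span_pair] at hzW
      obtain ⟨a, b, rfl⟩ := hzW
      have hb : b = 0 := by simpa [huv.symm] using hzv'
      subst hb
      have := congrFun hz v
      simp [mulVec_smul, h2] at this
      simp [this]
    have hle : LinearMap.ker A.mulVecLin ⊔ W ≤ LinearMap.ker (A.restr {u, v}ᶜ).mulVecLin := by
      refine sup_le (fun z hz => ?_) ?_
      · rw [LinearMap.mem_ker, mulVecLin_apply] at hz ⊢
        have hzv' := hzv z hz
        ext w
        by_cases hw : w ∈ ({u, v}ᶜ : Set V)
        · rw [← congrFun hz w]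
          refine Finset.sum_congr rfl fun x _ => ?_
          change A.restr {u, v}ᶜ w x * z x = A w x * z x
          by_cases hx : x ∈ ({u, v}ᶜ : Set V)
          · rw [restr_apply_of_mem hw hx]
          · rw [restr_apply_of_notMem_right hx, zero_mul]
            simp only [Set.mem_compl_iff, Set.mem_insert_iff, Set.mem_singleton_iff, not_or]
              at hx hw
            by_cases hxv : x = v
            · rw [hxv, hzv', mul_zero]
            · have hxu : x = u := by tauto
              rw [hxu, hc w hw.2, zero_mul]
        · exact Finset.sum_eq_zero fun x _ =>
            mul_eq_zero_of_left (restr_apply_of_notMem_left hw) _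
      · rw [hW, Submodule.span_le]
        rintro _ ⟨i, rfl⟩
        rw [SetLike.mem_coe, LinearMap.mem_ker, mulVecLin_apply]
        fin_cases i
        · ext w; simp [restr_apply_of_notMem_right]
        · ext w; simp [restr_apply_of_notMem_right]
    rw [← hWf, ← Submodule.finrank_sup_add_finrank_inf_eq, hdisj.eq_bot, finrank_bot]
    exact Submodule.finrank_mono hle

/-- Equal rank means that the columns outside X already span the column space. Hence column x is a
combination of them, and this relation is z. -/
theorem exists_mulVec_eq_zero_of_rank_restr {A : Matrix V V ℂ} {X : Set V}
    (h : (A.restr Xᶜ).rank = A.rank) {x : V} (hx : x ∈ X) :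
    ∃ z, A *ᵥ z = 0 ∧ z x = 1 ∧ ∀ y ∈ X, y ≠ x → z y = 0 := by
  classical
  rw [restr_eq_mul] at h
  have h1 : A.rank ≤ (A * coordProj Xᶜ).rank := h ▸ rank_mul_le_right _ _
  have h2 : LinearMap.range (A * coordProj Xᶜ).mulVecLin = LinearMap.range A.mulVecLin := by
    refine Submodule.eq_of_le_of_finrank_le ?_ h1
    rw [mulVecLin_mul]
    exact LinearMap.range_comp_le_range _ _
  have h3 : A *ᵥ Pi.single x 1 ∈ LinearMap.range (A * coordProj Xᶜ).mulVecLin := by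
    rw [h2]; exact ⟨_, rfl⟩
  obtain ⟨w, hw⟩ := h3
  rw [mulVecLin_apply, ← mulVec_mulVec] at hw
  have hz : ∀ y ∈ X, (coordProj Xᶜ *ᵥ w) y = 0 := fun y hy => by
    simp [coordProj, mulVec_diagonal, hy]
  refine ⟨Pi.single x 1 - coordProj Xᶜ *ᵥ w, ?_, ?_, fun y hy hyx => ?_⟩
  · rw [mulVec_sub, hw, sub_self]
  · rw [Pi.sub_apply, hz x hx]; simp
  · rw [Pi.sub_apply, hz y hy]; simp [hyx]

/-- Kernel vectors dual to the coordinates in T are independent, which bounds the nullity below by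
|T|. -/
theorem rank_add_card_le (A : Matrix V V ℂ) (T : Finset V)
    (h : ∀ t ∈ T, ∃ z, A *ᵥ z = 0 ∧ z t = 1 ∧ ∀ s ∈ T, s ≠ t → z s = 0) :
    A.rank + T.card ≤ Fintype.card V := by
  classical
  rw [← rank_add_finrank_ker A, Nat.add_le_add_iff_left]
  choose! z hz h1 h0 using h
  have hli : LinearIndependent ℂ (fun t : T => (⟨z t, by
      rw [LinearMap.mem_ker, mulVecLin_apply]; exact hz t t.2⟩ : LinearMap.ker A.mulVecLin)) := by
    rw [Fintype.linearIndependent_iff]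
    intro g hg t
    have := congrArg (fun y : LinearMap.ker A.mulVecLin => (y : V → ℂ) t) hg
    simp only [Submodule.coe_sum, Submodule.coe_smul, Finset.sum_apply, Pi.smul_apply,
      smul_eq_mul, Submodule.coe_zero, Pi.zero_apply] at this
    rwa [Finset.sum_eq_single t (fun s _ hst => by
      rw [h0 s s.2 t t.2 (fun e => hst (Subtype.ext e.symm)), mul_zero]) (by simp),
      h1 t t.2, mul_one] at this
  simpa using hli.fintype_card_le_finrank

/-- The kernel injects into the coordinates in T, which bounds the nullity above by |T|. -/
theorem card_le_rank_add_card (A : Matrix V V ℂ) (T : Finset V)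
    (h : ∀ z, A *ᵥ z = 0 → (∀ t ∈ T, z t = 0) → z = 0) :
    Fintype.card V ≤ A.rank + T.card := by
  classical
  rw [← rank_add_finrank_ker A, Nat.add_le_add_iff_left]
  let f : LinearMap.ker A.mulVecLin →ₗ[ℂ] (T → ℂ) :=
    (LinearMap.funLeft ℂ ℂ (Subtype.val : T → V)).comp (Submodule.subtype _)
  have hf : Function.Injective f := by
    rw [← LinearMap.ker_eq_bot, LinearMap.ker_eq_bot']
    rintro ⟨z, hz⟩ hfz
    rw [LinearMap.mem_ker, mulVecLin_apply] at hz
    exact Subtype.ext (h z hz fun t ht => congrFun hfz ⟨t, ht⟩)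
  simpa using LinearMap.finrank_le_finrank_of_injective hf

theorem rank_submatrix_val (A : Matrix V V ℂ) (S : Set V) [Fintype S] :
    (A.submatrix Subtype.val Subtype.val : Matrix S S ℂ).rank = (A.restr S).rank := by
  classical
  set P : Matrix V S ℂ := (1 : Matrix V V ℂ).submatrix id Subtype.val with hP
  set B : Matrix S S ℂ := A.submatrix Subtype.val Subtype.val with hB
  have hPB : ∀ (M : Matrix V V ℂ), Pᵀ * M * P = M.submatrix Subtype.val Subtype.val := fun M => by
    ext i j
    simp [hP, mul_apply, one_apply]
  have h1 : B = Pᵀ * A.restr S * P := by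
    rw [hPB]; ext i j; simp [hB, restr]
  have h2 : A.restr S = P * B * Pᵀ := by
    ext i j
    simp only [mul_apply, hP, submatrix_apply, id_eq, transpose_apply, one_apply]
    by_cases hj : j ∈ S
    · rw [Finset.sum_eq_single (⟨j, hj⟩ : S) (fun b _ hb => by
        rw [if_neg fun e => hb (Subtype.ext e.symm), mul_zero]) (by simp)]
      by_cases hi : i ∈ S
      · rw [Finset.sum_eq_single (⟨i, hi⟩ : S) (fun b _ hb => by
          rw [if_neg fun e => hb (Subtype.ext e.symm), zero_mul]) (by simp)]
        simp [restr, hi, hj, hB]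
      · rw [restr_apply_of_notMem_left hi, Finset.sum_eq_zero fun b _ => by
          rw [if_neg (ne_of_mem_of_not_mem b.2 hi).symm, zero_mul], zero_mul]
    · rw [restr_apply_of_notMem_right hj, Finset.sum_eq_zero fun b _ => by
        rw [if_neg (ne_of_mem_of_not_mem b.2 hj).symm, mul_zero]]
  apply le_antisymm
  · rw [h1]; exact (rank_mul_le_left _ _).trans (rank_mul_le_right _ _)
  · rw [h2]; exact (rank_mul_le_left _ _).trans (rank_mul_le_right _ _)

end Matrix

/-! ### Branches beyond a bridge. -/

namespace SimpleGraph

variable {V : Type*} {G H : SimpleGraph V}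

/-- The vertices on the side of `v` after deleting the edge `pv`. -/
def branch (G : SimpleGraph V) (p v : V) : Set V := {w | (G.deleteEdges {s(p, v)}).Reachable v w}

theorem reachable_deleteEdges_of_forall_ne {a b c w : V} (hle : H ≤ G) (h : H.Reachable a b)
    (hne : ∀ t, H.Reachable a t → t ≠ c) : (G.deleteEdges {s(c, w)}).Reachable a b := by
  obtain ⟨q⟩ := h
  induction q with
  | nil => exact Reachable.refl _
  | @cons x y z hxy _ ih =>
    refine Reachable.trans (Adj.reachable ?_) (ih fun t ht => hne t (hxy.reachable.trans ht))
    have hx := hne x (Reachable.refl _)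
    have hy := hne y hxy.reachable
    simp only [deleteEdges_adj, Set.mem_singleton_iff, Sym2.eq_iff]
    exact ⟨hle hxy, by tauto⟩

theorem reachable_deleteEdges_of_isCycle {u x y : V} {c : G.Walk u u} {e : Sym2 V}
    (he : e ∉ c.edges) (hx : x ∈ c.support) (hy : y ∈ c.support) :
    (G.deleteEdges {e}).Reachable x y := by
  classical
  have key : ∀ x ∈ c.support, (G.deleteEdges {e}).Reachable u x := fun x hx =>
    ⟨(c.takeUntil x hx).toDeleteEdges {e} fun e' he' h =>
      he (h ▸ c.edges_takeUntil_subset_edges hx he')⟩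
  exact (key x hx).symm.trans (key y hy)

theorem not_isPendant_exists_ne [Finite V] {p v : V} (h : G.Adj v p) (hv : ¬ G.IsPendant v) :
    ∃ w, G.Adj v w ∧ w ≠ p := by
  by_contra! hc
  refine hv ?_
  rw [IsPendant, Set.ncard_eq_one]
  exact ⟨p, Set.eq_singleton_iff_unique_mem.2 ⟨h, hc⟩⟩

theorem isBridge_of_not_isCyclic {u v : V} (h : G.Adj u v) (hu : ¬ G.IsCyclic u) :
    G.IsBridge s(u, v) := by
  by_contra hb
  exact hu (isCyclic_of_not_isBridge h hb)

section Descent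

variable {p v c w : V}

theorem sym2_ne_of_branch_child (hb : G.IsBridge s(p, v))
    (h1 : (G.deleteEdges {s(p, v)}).Reachable v c) (hne : ¬ (c = v ∧ w = p)) :
    s(c, w) ≠ s(p, v) := by
  intro e
  rcases Sym2.eq_iff.1 e with ⟨rfl, rfl⟩ | ⟨rfl, rfl⟩
  · exact isBridge_iff.1 hb h1.symm
  · exact hne ⟨rfl, rfl⟩

/-- The descent step. Since c is joined to v without using cw, everything beyond cw lies beyond pv,
while c itself does not lie beyond cw. The case excluded by `hne` is stepping back across pv. -/
theorem branch_ssubset (hb : G.IsBridge s(p, v))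
    (h1 : (G.deleteEdges {s(p, v)}).Reachable v c) (h2 : (G.deleteEdges {s(c, w)}).Reachable v c)
    (hcw : G.Adj c w) (hbw : G.IsBridge s(c, w)) (hne : ¬ (c = v ∧ w = p)) :
    G.branch c w ⊂ G.branch p v := by
  have hs := sym2_ne_of_branch_child hb h1 hne
  refine Set.ssubset_iff_exists.2 ⟨fun t ht => ?_, c, h1, fun h => isBridge_iff.1 hbw h.symm⟩
  have ht : (G.deleteEdges {s(c, w)}).Reachable w t := ht
  have h3 : (G.deleteEdges {s(v, p)}).Reachable w t := by
    refine reachable_deleteEdges_of_forall_ne (deleteEdges_le _) ht fun t' ht' e => ?_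
    subst e
    exact isBridge_iff.1 hbw (ht'.trans h2).symm
  rw [Sym2.eq_swap] at h3
  refine h1.trans (Reachable.trans (Adj.reachable ?_) h3)
  simp [deleteEdges_adj, hcw, hs]

theorem mem_branch_of_child {u : V} (hpv : G.Adj p v) (hb : G.IsBridge s(p, v))
    (h1 : (G.deleteEdges {s(p, v)}).Reachable v c) (h2 : (G.deleteEdges {s(c, w)}).Reachable v c)
    (hne : ¬ (c = v ∧ w = p)) (hu : u ∈ G.branch v p) : u ∈ G.branch w c := by
  have hs := sym2_ne_of_branch_child hb h1 hne
  have hu : (G.deleteEdges {s(v, p)}).Reachable p u := hu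
  change (G.deleteEdges {s(w, c)}).Reachable c u
  rw [Sym2.eq_swap (a := w)]
  rw [Sym2.eq_swap (a := v)] at hu
  refine h2.symm.trans (Reachable.trans (v := p) (Adj.reachable ?_) ?_)
  · simp only [deleteEdges_adj, Set.mem_singleton_iff]
    exact ⟨hpv.symm, fun e => hs (by rw [← e, Sym2.eq_swap])⟩
  · refine reachable_deleteEdges_of_forall_ne (deleteEdges_le _) hu fun t ht e => ?_
    subst e
    exact isBridge_iff.1 hb (ht.trans h1.symm)

end Descent

/-- At a non-cyclic end every edge is a bridge, and absence of pendant vertices provides one leading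
further. Branches shrink strictly, so the descent stops at a cyclic vertex. -/
theorem exists_isCyclic_mem_branch [Finite V] (hG : ∀ v, ¬ G.IsPendant v) {p v : V}
    (hpv : G.Adj p v) (hb : G.IsBridge s(p, v)) : ∃ x ∈ G.branch p v, G.IsCyclic x := by
  induction hn : (G.branch p v).ncard using Nat.strong_induction_on generalizing p v with
  | _ n ih =>
    by_cases hv : G.IsCyclic v
    · exact ⟨v, Reachable.refl _, hv⟩
    obtain ⟨w, hvw, hwp⟩ := not_isPendant_exists_ne hpv.symm (hG v)
    have hbw := isBridge_of_not_isCyclic hvw hv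
    have hss := branch_ssubset hb (Reachable.refl v) (Reachable.refl v) hvw hbw (by tauto)
    obtain ⟨x, hx, hxc⟩ := ih _ (hn ▸ Set.ncard_lt_ncard hss (Set.toFinite _)) hvw hbw rfl
    exact ⟨x, hss.subset hx, hxc⟩

end SimpleGraph

/-! ### Ranks of gain graphs, the upper bound and extremality. -/

namespace GainFunction

variable {V : Type*} {G H : SimpleGraph V}

/-- The gain function that is constantly one. -/
noncomputable def trivialGain (G : SimpleGraph V) : GainFunction G :=
  ⟨fun _ => 1, fun _ => inv_one.symm⟩

/-- The restriction of a gain function to a spanning subgraph. -/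
noncomputable def restrict (φ : GainFunction G) (h : H ≤ G) : GainFunction H :=
  ⟨fun d => φ.gain ⟨d.toProd, h d.adj⟩, fun d => φ.gain_symm ⟨d.toProd, h d.adj⟩⟩

/-- The restriction of a gain function to the edges inside `S`. -/
noncomputable def restr (φ : GainFunction G) (S : Set V) : GainFunction (G.restr S) :=
  φ.restrict (restr_le G S)

theorem adjMatrix_of_adj (φ : GainFunction G) {u v : V} (h : G.Adj u v) :
    φ.adjMatrix u v = φ.gain ⟨(u, v), h⟩ := by simp [adjMatrix, h]

theorem adjMatrix_of_not_adj (φ : GainFunction G) {u v : V} (h : ¬ G.Adj u v) :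
    φ.adjMatrix u v = 0 := by simp [adjMatrix, h]

theorem adjMatrix_ne_zero (φ : GainFunction G) {u v : V} (h : G.Adj u v) :
    φ.adjMatrix u v ≠ 0 := by
  rw [adjMatrix_of_adj φ h]; exact Circle.coe_ne_zero _

theorem adjMatrix_mul_symm (φ : GainFunction G) {u v : V} (h : G.Adj u v) :
    φ.adjMatrix u v * φ.adjMatrix v u = 1 := by
  rw [adjMatrix_of_adj φ h, adjMatrix_of_adj φ h.symm]
  have := φ.gain_symm ⟨(u, v), h⟩
  change φ.gain ⟨(v, u), h.symm⟩ = _ at this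
  rw [this, Circle.coe_inv, mul_inv_cancel₀ (Circle.coe_ne_zero _)]

theorem adjMatrix_trivialGain_of_adj {u v : V} (h : G.Adj u v) :
    (trivialGain G).adjMatrix u v = 1 := by
  rw [adjMatrix_of_adj _ h]; rfl

theorem adjMatrix_restr (φ : GainFunction G) (S : Set V) :
    (φ.restr S).adjMatrix = φ.adjMatrix.restr S := by
  ext u v
  by_cases h : (G.restr S).Adj u v
  · rw [adjMatrix_of_adj _ h, Matrix.restr_apply_of_mem h.1 h.2.1, adjMatrix_of_adj _ h.2.2]
    rfl
  · rw [adjMatrix_of_not_adj _ h]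
    by_cases hu : u ∈ S
    · by_cases hv : v ∈ S
      · rw [Matrix.restr_apply_of_mem hu hv, adjMatrix_of_not_adj _ fun h' => h ⟨hu, hv, h'⟩]
      · rw [Matrix.restr_apply_of_notMem_right hv]
    · rw [Matrix.restr_apply_of_notMem_left hu]

variable [Fintype V]

theorem rank_trivialGain (G : SimpleGraph V) : (trivialGain G).rank = G.adjRank := by
  classical
  unfold rank adjRank
  congr 1

theorem adjRank_restr (G : SimpleGraph V) (S : Set V) :
    (G.restr S).adjRank = ((trivialGain G).adjMatrix.restr S).rank := by
  rw [← rank_trivialGain, ← adjMatrix_restr]; rfl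

theorem rank_restr_eq (φ : GainFunction G) (S : Set V) :
    (φ.restr S).rank = (φ.adjMatrix.restr S).rank := by rw [← adjMatrix_restr]; rfl

theorem adjRank_restr_le (G : SimpleGraph V) (S : Set V) : (G.restr S).adjRank ≤ G.adjRank := by
  rw [adjRank_restr, ← rank_trivialGain]; exact Matrix.rank_restr_le _ _

theorem rank_le_rank_restr_add_two (φ : GainFunction G) (x : V) :
    φ.rank ≤ (φ.restr {x}ᶜ).rank + 2 := by
  rw [rank_restr_eq]; exact Matrix.rank_le_rank_restr_add_two _ _

theorem rank_eq_of_isPendant (φ : GainFunction G) {u v : V} (hu : G.IsPendant u)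
    (huv : G.Adj u v) : φ.rank = (φ.restr {u, v}ᶜ).rank + 2 := by
  have hn : ∀ w, w ≠ v → ¬ G.Adj u w := fun w hw h => by
    obtain ⟨a, ha⟩ := Set.ncard_eq_one.1 hu
    have h1 : w ∈ ({a} : Set V) := ha ▸ h
    have h2 : v ∈ ({a} : Set V) := ha ▸ huv
    exact hw (h1.trans h2.symm)
  rw [rank_restr_eq]
  exact Matrix.rank_eq_of_pendant huv.ne (adjMatrix_ne_zero φ huv) (adjMatrix_ne_zero φ huv.symm)
    (fun w hw => adjMatrix_of_not_adj φ (hn w hw))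
    (fun w hw => adjMatrix_of_not_adj φ fun h => hn w hw h.symm)

theorem adjRank_eq_of_isPendant {u v : V} (hu : G.IsPendant u) (huv : G.Adj u v) :
    G.adjRank = (G.restr {u, v}ᶜ).adjRank + 2 := by
  rw [← rank_trivialGain, rank_eq_of_isPendant _ hu huv, ← rank_trivialGain]; rfl

theorem rank_le_adjRank_add (φ : GainFunction G) :
    (φ.rank : ℤ) ≤ G.adjRank + 2 * G.cycleDim := by
  induction hn : G.edgeSet.ncard using Nat.strong_induction_on generalizing G with
  | _ n ih =>
    by_cases hc : ∃ x, G.IsCyclic x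
    · obtain ⟨x, hx⟩ := hc
      have hadj : ∃ y, G.Adj x y := by
        obtain ⟨c, hc⟩ := hx
        exact ⟨c.snd, c.adj_snd hc.not_nil⟩
      obtain ⟨y, hxy⟩ := hadj
      have h1 := ih _ (hn ▸ ncard_edgeSet_lt_of_lt (restr_lt_of_adj (S := {x}ᶜ) hxy (by simp)))
        (φ.restr {x}ᶜ) rfl
      have h2 := φ.rank_le_rank_restr_add_two x
      have h3 := adjRank_restr_le G {x}ᶜ
      have h4 := cycleDim_restr_compl_singleton_lt hx
      omega
    by_cases hp : ∃ u, G.IsPendant u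
    · obtain ⟨u, hu⟩ := hp
      obtain ⟨v, hv⟩ := Set.ncard_eq_one.1 hu
      have huv : G.Adj u v := by
        have : v ∈ G.neighborSet u := hv ▸ Set.mem_singleton v
        exact this
      have h1 := ih _ (hn ▸ ncard_edgeSet_lt_of_lt (restr_lt_of_adj (S := {u, v}ᶜ) huv (by simp)))
        (φ.restr {u, v}ᶜ) rfl
      have h2 := φ.rank_eq_of_isPendant hu huv
      have h3 := adjRank_eq_of_isPendant hu huv
      have h4 := cycleDim_mono (restr_le G {u, v}ᶜ)
      omega
    -- With no cyclic vertex every edge is a bridge, and with no pendant vertex a bridge would lead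
    -- to a cyclic one; so there are no edges.
    push Not at hc hp
    have hE : ∀ u v, ¬ G.Adj u v := fun u v huv => by
      obtain ⟨x, -, hx⟩ := exists_isCyclic_mem_branch hp huv (isBridge_of_not_isCyclic huv (hc u))
      exact hc x hx
    have hz : φ.adjMatrix = 0 := by
      ext u v; exact adjMatrix_of_not_adj φ (hE u v)
    have h0 : φ.rank = 0 := by rw [rank, hz, Matrix.rank_zero]
    have := cycleDim_nonneg (G := G)
    omega

/-- The gain graph attains the upper bound on its rank. -/
def IsExtremal (φ : GainFunction G) : Prop := (φ.rank : ℤ) = G.adjRank + 2 * G.cycleDim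

theorem IsExtremal.restr_of_isCyclic {φ : GainFunction G} (h : φ.IsExtremal) {x : V}
    (hx : G.IsCyclic x) : (φ.restr {x}ᶜ).IsExtremal ∧ (G.restr {x}ᶜ).adjRank = G.adjRank ∧
      (G.restr {x}ᶜ).cycleDim + 1 = G.cycleDim := by
  have h1 := (φ.restr {x}ᶜ).rank_le_adjRank_add
  have h2 := φ.rank_le_rank_restr_add_two x
  have h3 := adjRank_restr_le G {x}ᶜ
  have h4 := cycleDim_restr_compl_singleton_lt hx
  unfold IsExtremal at *
  omega

/-- Deleting u and v lowers both ranks by the same 2. If v were cyclic, θ would drop as well, and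
the bound for the smaller graph would rule out equality. -/
theorem IsExtremal.not_isCyclic_of_isPendant {φ : GainFunction G} (h : φ.IsExtremal) {u v : V}
    (hu : G.IsPendant u) (huv : G.Adj u v) : ¬ G.IsCyclic v := by
  intro hv
  have h1 := (φ.restr {u, v}ᶜ).rank_le_adjRank_add
  have h2 := φ.rank_eq_of_isPendant hu huv
  have h3 := adjRank_eq_of_isPendant hu huv
  have h4 := cycleDim_restr_compl_singleton_lt hv
  have h5 : (G.restr {u, v}ᶜ).cycleDim ≤ (G.restr {v}ᶜ).cycleDim := cycleDim_mono fun a b hab =>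
    ⟨fun e => hab.1 (Or.inr e), fun e => hab.2.1 (Or.inr e), hab.2.2⟩
  unfold IsExtremal at h
  omega

theorem IsExtremal.restr_of_isPendant {φ : GainFunction G} (h : φ.IsExtremal) {u v : V}
    (hu : G.IsPendant u) (huv : G.Adj u v) : (φ.restr {u, v}ᶜ).IsExtremal ∧
      (G.restr {u, v}ᶜ).cycleDim = G.cycleDim := by
  have h1 := cycleDim_restr_compl_pair (SimpleGraph.not_isCyclic_of_isPendant hu)
    (h.not_isCyclic_of_isPendant hu huv)
  have h2 := φ.rank_eq_of_isPendant hu huv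
  have h3 := adjRank_eq_of_isPendant hu huv
  unfold IsExtremal at *
  omega

end GainFunction

/-! ### Cycles that coincide once they meet. -/

namespace SimpleGraph

variable {V : Type*} {G H : SimpleGraph V}

theorem Walk.forall_mem_support_of_closed {P : V → Prop} {a b : V} (w : G.Walk a b) (ha : P a)
    (h : ∀ x y, P x → s(x, y) ∈ w.edges → P y) : ∀ x ∈ w.support, P x := by
  induction w with
  | nil => simpa using ha
  | @cons a c b hac w ih =>
    intro x hx
    rw [Walk.support_cons, List.mem_cons] at hx
    rcases hx with rfl | hx
    · exact ha
    · exact ih (h a c ha (by simp)) (fun x y hx hxy => h x y hx (by simp [hxy])) x hx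

theorem forall_of_reachable {P : V → Prop} {a b : V} (h : G.Reachable a b) (ha : P a)
    (hP : ∀ x y, P x → G.Adj x y → P y) : P b := by
  obtain ⟨w⟩ := h
  exact w.forall_mem_support_of_closed ha (fun x y hx hxy => hP x y hx (w.adj_of_mem_edges hxy)) b
    w.end_mem_support

/-- Two cycles with a common vertex have the same edges. -/
def CyclesCoincide (G : SimpleGraph V) : Prop :=
  ∀ ⦃u v : V⦄ (c : G.Walk u u) (d : G.Walk v v), c.IsCycle → d.IsCycle →
    ∀ x ∈ c.support, x ∈ d.support → ∀ e ∈ d.edges, e ∈ c.edges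

theorem Walk.IsCycle.exists_mem_edges {u x : V} {c : G.Walk u u} (hc : c.IsCycle)
    (hx : x ∈ c.support) : ∃ y, s(x, y) ∈ c.edges := by
  have h := hc.ncard_neighborSet_toSubgraph_eq_two hx
  obtain ⟨y, hy⟩ := Set.nonempty_of_ncard_ne_zero (h ▸ two_ne_zero)
  exact ⟨y, Walk.adj_toSubgraph_iff_mem_edges.1 hy⟩

theorem CyclesCoincide.toSubgraph_eq (hG : G.CyclesCoincide) {u v x : V} {c : G.Walk u u}
    {d : G.Walk v v} (hc : c.IsCycle) (hd : d.IsCycle) (hx : x ∈ c.support)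
    (hx' : x ∈ d.support) : c.toSubgraph = d.toSubgraph := by
  have h1 := hG c d hc hd x hx hx'
  have h2 := hG d c hd hc x hx' hx
  refine Subgraph.ext (Set.ext fun y => ?_) (funext₂ fun a b => propext ?_)
  · simp only [Walk.mem_verts_toSubgraph]
    constructor
    · intro hy
      obtain ⟨t, ht⟩ := hc.exists_mem_edges hy
      exact d.fst_mem_support_of_mem_edges (h2 _ ht)
    · intro hy
      obtain ⟨t, ht⟩ := hd.exists_mem_edges hy
      exact c.fst_mem_support_of_mem_edges (h1 _ ht)
  · simp only [Walk.adj_toSubgraph_iff_mem_edges]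
    exact ⟨h2 _, h1 _⟩

theorem CyclesCoincide.cyclesVertexDisjoint (hG : G.CyclesCoincide) :
    G.CyclesVertexDisjoint := by
  rintro _ _ ⟨u, c, hc, rfl⟩ ⟨v, d, hd, rfl⟩ hne
  rw [Set.disjoint_left]
  intro x hx hx'
  exact hne (hG.toSubgraph_eq hc hd (c.mem_verts_toSubgraph.1 hx) (d.mem_verts_toSubgraph.1 hx'))

theorem CyclesCoincide.isBridge (hG : G.CyclesCoincide) {u x y : V} {c : G.Walk u u}
    (hc : c.IsCycle) (hx : x ∈ c.support) (hxy : G.Adj x y) (hn : s(x, y) ∉ c.edges) :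
    G.IsBridge s(x, y) := by
  rw [isBridge_iff_forall_cycle_notMem hxy]
  intro v d hd he
  exact hn (hG c d hc hd x hx (d.fst_mem_support_of_mem_edges he) _ he)

theorem Walk.IsCycle.injOn_getVert_range {u : V} {c : G.Walk u u} (hc : c.IsCycle) :
    Set.InjOn c.getVert (Finset.range c.length : Finset ℕ) := fun i hi j hj h =>
  hc.getVert_injOn' (by simp at hi ⊢; omega) (by simp at hj ⊢; omega) h

theorem Walk.IsCycle.exists_getVert_lt {u x : V} {c : G.Walk u u} (hc : c.IsCycle)
    (hx : x ∈ c.support) : ∃ i < c.length, c.getVert i = x := by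
  obtain ⟨i, rfl, hi⟩ := Walk.mem_support_iff_exists_getVert.1 hx
  rcases hi.eq_or_lt with rfl | h
  · exact ⟨0, by have := hc.three_le_length; omega, by simp⟩
  · exact ⟨i, h, rfl⟩

theorem Walk.IsCycle.card_filter_mem_support [Fintype V] {u : V} {c : G.Walk u u}
    (hc : c.IsCycle) [DecidablePred (· ∈ c.support)] :
    (Finset.univ.filter (· ∈ c.support)).card = c.length := by
  classical
  have : Finset.univ.filter (· ∈ c.support) = (Finset.range c.length).image c.getVert := by
    ext x
    simp only [Finset.mem_filter, Finset.mem_univ, true_and, Finset.mem_image, Finset.mem_range]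
    exact ⟨fun h => hc.exists_getVert_lt h, fun ⟨i, _, h⟩ => h ▸ c.getVert_mem_support i⟩
  rw [this, Finset.card_image_of_injOn hc.injOn_getVert_range, Finset.card_range]

end SimpleGraph

/-! ### Kernel vectors along a cycle. -/

namespace GainFunction

variable {V : Type*} {G H : SimpleGraph V}

/-- The gain of the first `i` steps of a walk. -/
noncomputable def partialGain (φ : GainFunction G) {u v : V} (c : G.Walk u v) (i : ℕ) : ℂ :=
  ∏ j ∈ Finset.range i, φ.adjMatrix (c.getVert j) (c.getVert (j + 1))

theorem partialGain_zero (φ : GainFunction G) {u v : V} (c : G.Walk u v) :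
    φ.partialGain c 0 = 1 := by simp [partialGain]

theorem partialGain_succ (φ : GainFunction G) {u v : V} (c : G.Walk u v) (i : ℕ) :
    φ.partialGain c (i + 1) =
      φ.partialGain c i * φ.adjMatrix (c.getVert i) (c.getVert (i + 1)) :=
  Finset.prod_range_succ _ _

theorem partialGain_length (φ : GainFunction G) {u v : V} (c : G.Walk u v) :
    φ.partialGain c c.length = φ.walkGain c := by
  induction c with
  | nil => simp [partialGain, walkGain]
  | @cons a b d h w ih =>
    rw [partialGain, Walk.length_cons, Finset.prod_range_succ']
    simp only [Walk.getVert_cons_succ, Walk.getVert_zero, zero_add]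
    rw [← partialGain, ih, adjMatrix_of_adj φ h, mul_comm]
    simp [walkGain]

theorem partialGain_ne_zero (φ : GainFunction G) {u v : V} (c : G.Walk u v) {i : ℕ}
    (hi : i ≤ c.length) : φ.partialGain c i ≠ 0 :=
  Finset.prod_ne_zero_iff.2 fun j hj => adjMatrix_ne_zero φ
    (c.adj_getVert_succ (by have := Finset.mem_range.1 hj; omega))

theorem partialGain_pred_mul (φ : GainFunction G) {u v : V} (c : G.Walk u v) {i : ℕ}
    (hi : i < c.length) : φ.partialGain c (i + 1) *
      φ.adjMatrix (c.getVert (i + 1)) (c.getVert i) = φ.partialGain c i := by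
  rw [partialGain_succ, mul_assoc, adjMatrix_mul_symm φ (c.adj_getVert_succ hi), mul_one]

theorem walkGain_trivialGain {u v : V} (c : G.Walk u v) : (trivialGain G).walkGain c = 1 := by
  simp [walkGain, trivialGain]

theorem mem_edges_base_iff {u : V} {c : G.Walk u u} (hc : c.IsCycle) {w : V} :
    s(u, w) ∈ c.edges ↔ w = c.snd ∨ w = c.penultimate := by
  rw [← Walk.adj_toSubgraph_iff_mem_edges, ← Subgraph.mem_neighborSet,
    hc.neighborSet_toSubgraph_endpoint]
  rfl

variable [Fintype V]

theorem mulVec_eq_sum (φ : GainFunction G) {x : V} {z : V → ℂ} (T : Finset V)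
    (h : ∀ w, G.Adj x w → w ∉ T → z w = 0) :
    (φ.adjMatrix.mulVec z) x = ∑ w ∈ T, φ.adjMatrix x w * z w := by
  classical
  refine (Finset.sum_subset (Finset.subset_univ T) fun w _ hw => ?_).symm
  by_cases hxw : G.Adj x w
  · rw [h w hxw hw, mul_zero]
  · exact mul_eq_zero_of_left (adjMatrix_of_not_adj φ hxw) _

section Cycle

variable (φ : GainFunction G) {u : V} {c : G.Walk u u} {z : V → ℂ}

theorem mulVec_getVert_succ (hc : c.IsCycle) {i : ℕ} (hi : i + 1 < c.length)
    (h : ∀ w, G.Adj (c.getVert (i + 1)) w → s(c.getVert (i + 1), w) ∉ c.edges → z w = 0) :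
    (φ.adjMatrix.mulVec z) (c.getVert (i + 1)) =
      φ.adjMatrix (c.getVert (i + 1)) (c.getVert i) * z (c.getVert i) +
      φ.adjMatrix (c.getVert (i + 1)) (c.getVert (i + 2)) * z (c.getVert (i + 2)) := by
  classical
  have hN := hc.neighborSet_toSubgraph_internal (i := i + 1) (by omega) hi
  have hne : c.getVert i ≠ c.getVert (i + 2) :=
    hc.getVert_sub_one_ne_getVert_add_one (i := i + 1) (by omega)
  rw [mulVec_eq_sum φ {c.getVert i, c.getVert (i + 2)} fun w hw hT => h w hw fun he => hT ?_,
    Finset.sum_pair hne]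
  have : w ∈ c.toSubgraph.neighborSet (c.getVert (i + 1)) :=
    Walk.adj_toSubgraph_iff_mem_edges.2 he
  rw [hN] at this
  simpa using this

theorem mulVec_base (hc : c.IsCycle)
    (h : ∀ w, G.Adj u w → s(u, w) ∉ c.edges → z w = 0) :
    (φ.adjMatrix.mulVec z) u =
      φ.adjMatrix u c.snd * z c.snd + φ.adjMatrix u c.penultimate * z c.penultimate := by
  classical
  rw [mulVec_eq_sum φ {c.snd, c.penultimate} fun w hw hT => h w hw fun he => hT ?_,
    Finset.sum_pair hc.snd_ne_penultimate]
  simpa using (mem_edges_base_iff hc).1 he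

theorem mulVec_base_of_adj (hc : c.IsCycle) {p : V} (hp : s(u, p) ∉ c.edges)
    (h : ∀ w, G.Adj u w → s(u, w) ∉ c.edges → w ≠ p → z w = 0) :
    (φ.adjMatrix.mulVec z) u = φ.adjMatrix u p * z p +
      (φ.adjMatrix u c.snd * z c.snd + φ.adjMatrix u c.penultimate * z c.penultimate) := by
  classical
  rw [mem_edges_base_iff hc, not_or] at hp
  rw [mulVec_eq_sum φ {p, c.snd, c.penultimate} fun w hw hT => h w hw (fun he => hT ?_) ?_,
    Finset.sum_insert (by simpa using hp), Finset.sum_pair hc.snd_ne_penultimate]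
  · have := (mem_edges_base_iff hc).1 he
    simp [this]
  · rintro rfl; simp at hT

/-- `z` satisfies the kernel equations at the vertices of `c` other than its base point, and these
equations involve only vertices of `c`. -/
def InteriorKernel (c : G.Walk u u) (z : V → ℂ) : Prop :=
  ∀ i, i + 1 < c.length → (φ.adjMatrix.mulVec z) (c.getVert (i + 1)) = 0 ∧
    ∀ w, G.Adj (c.getVert (i + 1)) w → s(c.getVert (i + 1), w) ∉ c.edges → z w = 0

variable {φ}

/-- Weighting z by the partial gains absorbs the edge gains, so the kernel equation becomes y(i+2) =
-y(i). -/
theorem InteriorKernel.rec_two (h : φ.InteriorKernel c z) (hc : c.IsCycle) {i : ℕ}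
    (hi : i + 2 ≤ c.length) : φ.partialGain c (i + 2) * z (c.getVert (i + 2)) =
      -(φ.partialGain c i * z (c.getVert i)) := by
  obtain ⟨h1, h2⟩ := h i (by omega)
  rw [mulVec_getVert_succ φ hc (by omega) h2] at h1
  rw [partialGain_succ φ c (i + 1), ← partialGain_pred_mul φ c (i := i) (by omega)]
  linear_combination φ.partialGain c (i + 1) * h1

theorem InteriorKernel.even (h : φ.InteriorKernel c z) (hc : c.IsCycle) {k : ℕ}
    (hk : 2 * k ≤ c.length) :
    φ.partialGain c (2 * k) * z (c.getVert (2 * k)) = (-1) ^ k * z u := by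
  induction k with
  | zero => simp [partialGain_zero]
  | succ k ih =>
    rw [show 2 * (k + 1) = 2 * k + 2 by ring, h.rec_two hc (by omega), ih (by omega)]
    ring

theorem InteriorKernel.odd (h : φ.InteriorKernel c z) (hc : c.IsCycle) {k : ℕ}
    (hk : 2 * k + 1 ≤ c.length) :
    φ.partialGain c (2 * k + 1) * z (c.getVert (2 * k + 1)) =
      (-1) ^ k * (φ.adjMatrix u c.snd * z c.snd) := by
  induction k with
  | zero => simp [partialGain]
  | succ k ih =>
    rw [show 2 * (k + 1) + 1 = 2 * k + 1 + 2 by ring, h.rec_two hc (by omega), ih (by omega)]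
    ring

theorem InteriorKernel.eq_zero (h : φ.InteriorKernel c z) (hc : c.IsCycle) (h0 : z u = 0)
    (h1 : z c.snd = 0) : ∀ x ∈ c.support, z x = 0 := by
  intro x hx
  obtain ⟨i, hi, rfl⟩ := hc.exists_getVert_lt hx
  obtain ⟨k, hk | hk⟩ := Nat.even_or_odd' i
  · subst hk
    have := h.even hc hi.le
    rw [h0, mul_zero] at this
    exact (mul_eq_zero.1 this).resolve_left (φ.partialGain_ne_zero c hi.le)
  · subst hk
    have := h.odd hc hi.le
    rw [h1, mul_zero, mul_zero] at this
    exact (mul_eq_zero.1 this).resolve_left (φ.partialGain_ne_zero c hi.le)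

/-- `z` satisfies the kernel equations at the vertices of `c`, and these equations involve only
vertices of `c`. -/
def CycleKernel (φ : GainFunction G) (c : G.Walk u u) (z : V → ℂ) : Prop :=
  ∀ x ∈ c.support, (φ.adjMatrix.mulVec z) x = 0 ∧
    ∀ w, G.Adj x w → s(x, w) ∉ c.edges → z w = 0

theorem CycleKernel.interiorKernel (h : φ.CycleKernel c z) : φ.InteriorKernel c z :=
  fun _ _ => h _ (c.getVert_mem_support _)

theorem CycleKernel.wrap (h : φ.CycleKernel c z) (hc : c.IsCycle) :
    φ.walkGain c * (φ.adjMatrix u c.snd * z c.snd) =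
      -(φ.partialGain c (c.length - 1) * z (c.getVert (c.length - 1))) := by
  obtain ⟨h1, h2⟩ := h u c.start_mem_support
  rw [mulVec_base φ hc h2] at h1
  have h3 := hc.three_le_length
  have h4 := partialGain_pred_mul φ c (i := c.length - 1) (by omega)
  rw [show c.length - 1 + 1 = c.length by omega, c.getVert_length, partialGain_length] at h4
  change φ.walkGain c * φ.adjMatrix u c.penultimate = _ at h4
  rw [← h4]
  change _ = -(φ.walkGain c * φ.adjMatrix u c.penultimate * z c.penultimate)
  linear_combination φ.walkGain c * h1

/-- Even and odd positions decouple on a cycle of length 2m. One turn multiplies each class by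
(-1)^m, while the weights change by the gain. -/
theorem CycleKernel.walkGain_mul (h : φ.CycleKernel c z) (hc : c.IsCycle) {m : ℕ}
    (hm : c.length = 2 * m) : φ.walkGain c * z u = (-1) ^ m * z u ∧
      φ.walkGain c * (φ.adjMatrix u c.snd * z c.snd) =
        (-1) ^ m * (φ.adjMatrix u c.snd * z c.snd) := by
  have h3 := hc.three_le_length
  constructor
  · have := h.interiorKernel.even hc (k := m) hm.ge
    rwa [← hm, partialGain_length, c.getVert_length] at this
  · obtain ⟨k, rfl⟩ : ∃ k, m = k + 1 := ⟨m - 1, by omega⟩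
    rw [h.wrap hc, show c.length - 1 = 2 * k + 1 by omega, h.interiorKernel.odd hc (by omega)]
    ring

theorem CycleKernel.eq_zero_of_walkGain_ne (h : φ.CycleKernel c z) (hc : c.IsCycle)
    (he : Even c.length) (hg : φ.walkGain c ≠ (-1) ^ (c.length / 2)) :
    ∀ x ∈ c.support, z x = 0 := by
  obtain ⟨m, hm⟩ := he.two_dvd
  rw [hm, Nat.mul_div_cancel_left _ two_pos] at hg
  obtain ⟨h1, h2⟩ := h.walkGain_mul hc hm
  have h1 := (mul_eq_mul_right_iff.1 h1).resolve_left hg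
  have h2 := (mul_eq_mul_right_iff.1 h2).resolve_left hg
  exact h.interiorKernel.eq_zero hc h1
    ((mul_eq_zero.1 h2).resolve_left (adjMatrix_ne_zero φ (c.adj_snd hc.not_nil)))

/-- If the length is 2m with m odd, the gain 1 differs from (-1)^m. If it is odd, one turn exchanges
the two parity classes, and going round twice gives z u = -z u. -/
theorem CycleKernel.eq_zero_of_trivialGain (h : (trivialGain G).CycleKernel c z) (hc : c.IsCycle)
    (hn : ¬ 4 ∣ c.length) : ∀ x ∈ c.support, z x = 0 := by
  have h3 := hc.three_le_length
  obtain ⟨m, hm | hm⟩ := Nat.even_or_odd' c.length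
  · refine h.eq_zero_of_walkGain_ne hc ⟨m, by omega⟩ ?_
    have hodd : Odd m := by
      rw [← Nat.not_even_iff_odd]
      rintro ⟨k, rfl⟩
      exact hn ⟨k, by omega⟩
    rw [walkGain_trivialGain, hm, Nat.mul_div_cancel_left _ two_pos, hodd.neg_one_pow]
    norm_num
  · have h1 := h.interiorKernel.odd hc (k := m) hm.ge
    rw [← hm, partialGain_length, c.getVert_length] at h1
    have h2 := h.wrap hc
    rw [show c.length - 1 = 2 * m by omega, h.interiorKernel.even hc (by omega)] at h2
    rw [walkGain_trivialGain, one_mul] at h1 h2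
    have h4 : ((-1 : ℂ) ^ m) * (-1) ^ m = 1 := by rw [← mul_pow]; norm_num
    have h0 : z u = 0 := by
      rw [h2] at h1
      linear_combination (1 / 2) * h1 - (1 / 2) * z u * h4
    rw [h0, mul_zero, neg_zero] at h2
    exact h.interiorKernel.eq_zero hc h0
      ((mul_eq_zero.1 h2).resolve_left (adjMatrix_ne_zero _ (c.adj_snd hc.not_nil)))

/-- From position 1 to the last position there is an odd number of sign changes. So the cycle
contributes nothing to the kernel equation at its base, even when that base has neighbours off the
cycle. -/
theorem InteriorKernel.snd_add_penultimate (h : (trivialGain G).InteriorKernel c z)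
    (hc : c.IsCycle) (hn : 4 ∣ c.length) : z c.snd + z c.penultimate = 0 := by
  have h3 := hc.three_le_length
  obtain ⟨k, hk⟩ := hn
  obtain ⟨j, rfl⟩ : ∃ j, k = j + 1 := ⟨k - 1, by omega⟩
  have h1 := h.odd hc (k := 2 * j + 1) (by omega)
  have hg : ∀ i ≤ c.length, (trivialGain G).partialGain c i = 1 := fun i hi =>
    Finset.prod_eq_one fun j hj => adjMatrix_trivialGain_of_adj
      (c.adj_getVert_succ (by have := Finset.mem_range.1 hj; omega))
  rw [hg _ (by omega), adjMatrix_trivialGain_of_adj (c.adj_snd hc.not_nil),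
    show 2 * (2 * j + 1) + 1 = c.length - 1 by omega, pow_succ, pow_mul] at h1
  change 1 * z c.penultimate = _ at h1
  norm_num at h1
  rw [h1]; ring

theorem exists_mulVec_eq_zero_of_walkGain_eq (hc : c.IsCycle)
    (hcl : ∀ x ∈ c.support, ∀ w, G.Adj x w → s(x, w) ∈ c.edges) (he : Even c.length)
    (hg : φ.walkGain c = (-1) ^ (c.length / 2)) (α β : ℂ) :
    ∃ z, φ.adjMatrix.mulVec z = 0 ∧ z u = α ∧ z c.snd = β ∧ ∀ x ∉ c.support, z x = 0 := by
  classical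
  obtain ⟨m, hm⟩ := he.two_dvd
  have h3 := hc.three_le_length
  rw [hm, Nat.mul_div_cancel_left _ two_pos] at hg
  have hpm : ((-1 : ℂ) ^ m) * (-1) ^ m = 1 := by rw [← mul_pow]; norm_num
  -- The solution of y(i+2) = -y(i). The factor at odd positions makes the unweighted value at
  -- `c.snd` equal to β.
  set y : ℕ → ℂ := fun i => (-1) ^ (i / 2) *
    (if i % 2 = 0 then α else φ.adjMatrix u c.snd * β) with hy
  have hy2 : ∀ i, y (i + 2) = - y i := fun i => by
    simp only [hy, Nat.add_mod_right, Nat.add_div_right _ two_pos, pow_succ]; ring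
  set Z : ℕ → ℂ := fun i => (φ.partialGain c i)⁻¹ * y i with hZ
  -- Closing up: after 2m steps y has acquired (-1)^m, which the gain cancels.
  have hZn : Z c.length = Z 0 := by
    simp only [hZ, hy, partialGain_length, partialGain_zero, hg]
    simp [hm]
  choose! idx hidx1 hidx2 using fun x (hx : x ∈ c.support) => hc.exists_getVert_lt hx
  set z : V → ℂ := fun x => if x ∈ c.support then Z (idx x) else 0 with hz
  have hzv : ∀ i ≤ c.length, z (c.getVert i) = Z i := by
    have key : ∀ i < c.length, z (c.getVert i) = Z i := fun i hi => by
      have hmem := c.getVert_mem_support i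
      simp only [hz, if_pos hmem]
      rw [hc.injOn_getVert_range (by simpa using hidx1 _ hmem) (by simpa using hi) (hidx2 _ hmem)]
    intro i hi
    rcases hi.eq_or_lt with rfl | hi
    · rw [hZn, c.getVert_length, ← key 0 (by omega), c.getVert_zero]
    · exact key i hi
  have hp0 : ∀ i ≤ c.length, φ.partialGain c i ≠ 0 := fun i hi => φ.partialGain_ne_zero c hi
  have hzu : z u = α := by
    have := hzv 0 (by omega)
    simpa [hZ, hy, partialGain_zero] using this
  have hzs : z c.snd = β := by
    have := hzv 1 (by omega)
    have hne := adjMatrix_ne_zero φ (c.adj_snd hc.not_nil)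
    change z c.snd = _ at this
    rw [this]
    simp only [hZ, hy, partialGain, Finset.prod_range_one, c.getVert_zero]
    change (φ.adjMatrix u c.snd)⁻¹ * _ = β
    norm_num
    field_simp
  refine ⟨z, funext fun x => ?_, hzu, hzs, fun x hx => by simp [hz, hx]⟩
  by_cases hx : x ∈ c.support
  · obtain ⟨i, hi, rfl⟩ := hc.exists_getVert_lt hx
    rcases i with _ | i
    · rw [c.getVert_zero, mulVec_base φ hc fun w hw hn =>
        absurd (hcl u c.start_mem_support w hw) hn, hzs]
      have h4 := partialGain_pred_mul φ c (i := c.length - 1) (by omega)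
      rw [show c.length - 1 + 1 = c.length by omega, c.getVert_length, partialGain_length] at h4
      change φ.walkGain c * φ.adjMatrix u c.penultimate = _ at h4
      have hpen : z c.penultimate = _ := hzv (c.length - 1) (by omega)
      obtain ⟨k, rfl⟩ : ∃ k, m = k + 1 := ⟨m - 1, by omega⟩
      have hyn : y (c.length - 1) = (-1) ^ k * (φ.adjMatrix u c.snd * β) := by
        simp only [hy]
        rw [if_neg (by omega), show (c.length - 1) / 2 = k by omega]
      rw [hpen]
      simp only [hZ]
      rw [hyn, ← h4, hg]
      have hA := adjMatrix_ne_zero φ (c.adj_penultimate hc.not_nil).symm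
      rw [mul_inv]
      rw [pow_succ] at hpm ⊢
      have hk : ((-1 : ℂ) ^ k) ≠ 0 := pow_ne_zero _ (by norm_num)
      simp only [Pi.zero_apply]
      field_simp
      ring
    · rw [mulVec_getVert_succ φ hc hi fun w hw hn => absurd (hcl _ hx w hw) hn,
        hzv i (by omega), hzv (i + 2) (by omega)]
      simp only [hZ, hy2, Pi.zero_apply]
      have h1 := partialGain_pred_mul φ c (i := i) (by omega)
      have h2 := partialGain_succ φ c (i + 1)
      have e0 := hp0 i (by omega)
      have e1 := hp0 (i + 1) (by omega)
      have e2 := hp0 (i + 2) (by omega)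
      have f1 : φ.adjMatrix (c.getVert (i + 1)) (c.getVert i) * (φ.partialGain c i)⁻¹ =
          (φ.partialGain c (i + 1))⁻¹ := by
        field_simp; linear_combination h1
      have f2 : φ.adjMatrix (c.getVert (i + 1)) (c.getVert (i + 2)) *
          (φ.partialGain c (i + 2))⁻¹ = (φ.partialGain c (i + 1))⁻¹ := by
        field_simp; linear_combination -h2
      linear_combination y i * f1 - y i * f2
  · rw [mulVec_eq_sum φ ∅ fun w hw _ => ?_]
    · simp
    · have : w ∉ c.support := fun h => hx
        (c.snd_mem_support_of_mem_edges (hcl w h x hw.symm))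
      simp [hz, this]

end Cycle

end GainFunction

/-! ### Cycles seen across bridges. -/

namespace SimpleGraph

variable {V : Type*} {G H : SimpleGraph V}

theorem Walk.mem_edgeSet_restr {u v : V} {c : G.Walk u v} {S : Set V}
    (hS : ∀ x ∈ c.support, x ∈ S) : ∀ e ∈ c.edges, e ∈ (G.restr S).edgeSet := by
  intro e he
  induction e using Sym2.ind with
  | _ a b =>
    exact ⟨hS a (c.fst_mem_support_of_mem_edges he), hS b (c.snd_mem_support_of_mem_edges he),
      c.adj_of_mem_edges he⟩

theorem IsBridge.notMem_branch_swap_of_isCycle {u v p w : V} {c : G.Walk w w}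
    (hb : G.IsBridge s(p, v)) (hu : u ∈ G.branch v p) (hc : c.IsCycle) (huc : u ∈ c.support) :
    v ∉ c.support := by
  intro hv
  have h1 := reachable_deleteEdges_of_isCycle (hb.notMem_edges_of_isCycle hc) huc hv
  have hu : (G.deleteEdges {s(v, p)}).Reachable p u := hu
  rw [Sym2.eq_swap] at hu
  exact isBridge_iff.1 hb (hu.trans h1)

/-- Two bridges at different vertices of one cycle lead away from each other, so u cannot lie beyond
both. -/
theorem eq_of_mem_support_of_isBridge {u v v' p p' w : V} {c : G.Walk w w}
    (hpv : G.Adj p v) (hb : G.IsBridge s(p, v)) (hb' : G.IsBridge s(p', v'))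
    (hu : u ∈ G.branch v p) (hu' : u ∈ G.branch v' p') (hc : c.IsCycle) (hv : v ∈ c.support)
    (hv' : v' ∈ c.support) : v = v' := by
  by_contra hne
  have h1 := reachable_deleteEdges_of_isCycle (hb.notMem_edges_of_isCycle hc) hv hv'
  have h2 := reachable_deleteEdges_of_isCycle (hb'.notMem_edges_of_isCycle hc) hv' hv
  have hu : (G.deleteEdges {s(v, p)}).Reachable p u := hu
  have hu' : (G.deleteEdges {s(v', p')}).Reachable p' u := hu'
  rw [Sym2.eq_swap] at hu
  have h3 : (G.deleteEdges {s(v', p')}).Reachable p u := by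
    refine reachable_deleteEdges_of_forall_ne (deleteEdges_le _) hu fun t ht e => ?_
    subst e
    exact isBridge_iff.1 hb (ht.trans h1.symm)
  rw [Sym2.eq_swap] at h3 hu'
  have h4 : (G.deleteEdges {s(p', v')}).Reachable v p := by
    refine Adj.reachable ?_
    simp only [deleteEdges_adj, Set.mem_singleton_iff]
    refine ⟨hpv.symm, fun e => ?_⟩
    rcases Sym2.eq_iff.1 e with ⟨rfl, rfl⟩ | ⟨rfl, rfl⟩
    · exact isBridge_iff.1 hb' h2.symm
    · exact hne rfl
  exact isBridge_iff.1 hb' (hu'.trans (h2.trans (h4.trans h3)).symm)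

theorem restr_restr (G : SimpleGraph V) (S T : Set V) : (G.restr S).restr T = G.restr (S ∩ T) := by
  ext a b
  simp only [restr_adj, Set.mem_inter_iff]
  tauto

end SimpleGraph

theorem Matrix.restr_restr {V : Type*} (A : Matrix V V ℂ) (S T : Set V) :
    (A.restr S).restr T = A.restr (S ∩ T) := by
  ext a b
  simp only [Matrix.restr, Matrix.of_apply]
  split_ifs <;> grind

/-! ### Consequences of extremality. -/

namespace GainFunction

variable {V : Type*} {G H : SimpleGraph V}

theorem walkGain_transfer (φ : GainFunction G) (hle : H ≤ G) {u v : V} (c : G.Walk u v)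
    (hc : ∀ e ∈ c.edges, e ∈ H.edgeSet) :
    (φ.restrict hle).walkGain (c.transfer H hc) = φ.walkGain c := by
  induction c with
  | nil => simp [walkGain]
  | cons h p ih =>
    have e : φ.walkGain (Walk.cons h p) = φ.gain ⟨(_, _), h⟩ * φ.walkGain p := List.prod_cons
    rw [e, ← ih fun e he => hc e (by simp [he])]
    exact List.prod_cons

theorem IsTypeB.of_transfer {φ : GainFunction G} (hle : H ≤ G) {u : V} {c : G.Walk u u}
    {hc : ∀ e ∈ c.edges, e ∈ H.edgeSet} (h : (φ.restrict hle).IsTypeB (c.transfer H hc)) :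
    φ.IsTypeB c := by
  unfold IsTypeB at *
  rwa [walkGain_transfer, Walk.length_transfer] at h

variable [Fintype V]

theorem IsExtremal.restr_inter {φ : GainFunction G} {S T : Set V}
    (h : ((φ.restr S).restr T).IsExtremal) : (φ.restr (S ∩ T)).IsExtremal := by
  unfold IsExtremal at *
  rwa [rank_restr_eq, adjMatrix_restr, Matrix.restr_restr, ← rank_restr_eq,
    SimpleGraph.restr_restr] at h

theorem IsExtremal.restr_univ {φ : GainFunction G} (h : φ.IsExtremal) :
    (φ.restr Set.univ).IsExtremal := by
  unfold IsExtremal at *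
  have : φ.adjMatrix.restr Set.univ = φ.adjMatrix := by ext; simp [Matrix.restr]
  rw [rank_restr_eq, this, SimpleGraph.restr_univ]
  exact h

/-- If d left c at x, deleting x would lower θ by 2, whereas extremality allows exactly 1. So d
never leaves c. -/
theorem IsExtremal.cyclesCoincide {φ : GainFunction G} (h : φ.IsExtremal) :
    G.CyclesCoincide := by
  intro u v c d hc hd x₀ hx₀ hx₀'
  have key : ∀ x y, x ∈ c.support → s(x, y) ∈ d.edges → s(x, y) ∈ c.edges := by
    intro x y hx he
    by_contra hne
    have h1 := cycleDim_restr_compl_singleton_lt_of_two_cycles hc hd hx he hne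
    have h2 := (h.restr_of_isCyclic (isCyclic_of_mem_support hc hx)).2.2
    omega
  have hsub : ∀ x ∈ d.support, x ∈ c.support := by
    classical
    intro x hx
    refine (d.rotate x₀ hx₀').forall_mem_support_of_closed (P := (· ∈ c.support)) hx₀
      (fun a b ha hab => ?_) x (by simpa using hx)
    rw [(d.rotate_edges x₀ hx₀').mem_iff] at hab
    exact c.snd_mem_support_of_mem_edges (key a b ha hab)
  intro e he
  induction e using Sym2.ind with
  | _ a b => exact key a b (hsub a (d.fst_mem_support_of_mem_edges he)) he

section Unicyclic

variable {u : V} {c : G.Walk u u}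

theorem mulVec_single_eq_zero (φ : GainFunction G) [DecidableEq V] {t : V}
    (ht : ∀ x, ¬ G.Adj x t) : φ.adjMatrix.mulVec (Pi.single t 1) = 0 := by
  ext x
  rw [Matrix.mulVec_single_one]
  exact adjMatrix_of_not_adj φ (ht x)

/-- An extremal gain graph all of whose edges lie on one cycle. -/
theorem IsExtremal.isTypeB_of_forall_mem_edges {φ : GainFunction G} (h : φ.IsExtremal)
    (hc : c.IsCycle) (hE : ∀ x y, G.Adj x y → s(x, y) ∈ c.edges) :
    φ.IsTypeB c ∧ 4 ∣ c.length := by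
  classical
  have hθ : 1 ≤ G.cycleDim := by
    have := (h.restr_of_isCyclic ⟨c, hc⟩).2.2
    have := cycleDim_nonneg (G := G.restr {u}ᶜ)
    omega
  have hrank : G.adjRank + 2 ≤ φ.rank := by unfold IsExtremal at h; omega
  have hcl : ∀ x ∈ c.support, ∀ w, G.Adj x w → s(x, w) ∈ c.edges := fun x _ w => hE x w
  have hiso : ∀ t ∉ c.support, ∀ x, ¬ G.Adj x t := fun t ht x hx =>
    ht (c.snd_mem_support_of_mem_edges (hE x t hx))
  have hker : ∀ (ψ : GainFunction G) (z : V → ℂ), ψ.adjMatrix.mulVec z = 0 →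
      ψ.CycleKernel c z := fun ψ z hz x hx =>
    ⟨congrFun hz x, fun w hw hn => absurd (hcl x hx w hw) hn⟩
  set T : Finset V := Finset.univ.filter (· ∉ c.support) with hT
  have hmT : ∀ {t}, t ∈ T ↔ t ∉ c.support := by simp [hT]
  have hTc : T.card + c.length = Fintype.card V := by
    rw [← hc.card_filter_mem_support, add_comm]
    exact Finset.card_filter_add_card_filter_not _
  have hsndT : c.snd ∉ T := by
    rw [hmT, not_not]; exact c.getVert_mem_support 1
  have huT : u ∉ insert c.snd T := by
    simp [hmT, (c.adj_snd hc.not_nil).ne]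
  have hT2 : (insert u (insert c.snd T)).card = T.card + 2 := by
    rw [Finset.card_insert_of_notMem huT, Finset.card_insert_of_notMem hsndT]
  have hle : φ.rank + T.card ≤ Fintype.card V := by
    refine Matrix.rank_add_card_le _ _ fun t ht =>
      ⟨Pi.single t 1, mulVec_single_eq_zero φ (hiso t (hmT.1 ht)), by simp, fun s _ hs => ?_⟩
    simp [hs]
  rw [← rank_trivialGain] at hrank
  -- Otherwise the kernel for G is determined by the isolated vertices `T`, so r(G) ≥ |V| - |T| ≥
  -- r(Φ), against `hrank`.
  have h4 : 4 ∣ c.length := by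
    by_contra hn
    have : Fintype.card V ≤ (trivialGain G).rank + T.card := by
      refine Matrix.card_le_rank_add_card _ _ fun z hz h0 => funext fun x => ?_
      by_cases hx : x ∈ c.support
      · exact (hker _ z hz).eq_zero_of_trivialGain hc hn x hx
      · exact h0 x (hmT.2 hx)
    omega
  have heven : Even c.length := by
    obtain ⟨k, hk⟩ := h4
    exact ⟨2 * k, by omega⟩
  refine ⟨⟨heven, fun hg => ?_⟩, h4⟩
  -- The nullity of G is at most |T| + 2. With gain (-1)^(p/2) that of Φ is at least |T| + 2, so
  -- r(Φ) ≤ r(G), again against `hrank`.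
  have h1 : Fintype.card V ≤ (trivialGain G).rank + (T.card + 2) := by
    rw [← hT2]
    refine Matrix.card_le_rank_add_card _ _ fun z hz h0 => funext fun x => ?_
    by_cases hx : x ∈ c.support
    · exact (hker _ z hz).interiorKernel.eq_zero hc (h0 u (by simp)) (h0 c.snd (by simp)) x hx
    · exact h0 x (by simp [hmT, hx])
  have h2 : φ.rank + (T.card + 2) ≤ Fintype.card V := by
    rw [← hT2]
    refine Matrix.rank_add_card_le _ _ fun t ht => ?_
    have hex := exists_mulVec_eq_zero_of_walkGain_eq hc hcl heven hg
    rw [Finset.mem_insert, Finset.mem_insert] at ht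
    rcases ht with rfl | rfl | ht
    · obtain ⟨z, hz, h1, h2, h3⟩ := hex 1 0
      refine ⟨z, hz, h1, fun s hs hne => ?_⟩
      rw [Finset.mem_insert, Finset.mem_insert] at hs
      rcases hs with rfl | rfl | hs
      · exact absurd rfl hne
      · exact h2
      · exact h3 s (hmT.1 hs)
    · obtain ⟨z, hz, h1, h2, h3⟩ := hex 0 1
      refine ⟨z, hz, h2, fun s hs hne => ?_⟩
      rw [Finset.mem_insert, Finset.mem_insert] at hs
      rcases hs with rfl | rfl | hs
      · exact h1
      · exact absurd rfl hne
      · exact h3 s (hmT.1 hs)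
    · exact ⟨Pi.single t 1, mulVec_single_eq_zero φ (hiso t (hmT.1 ht)), by simp,
        fun s _ hs => by simp [hs]⟩
  omega

end Unicyclic

/-- Pendant pairs and cyclic vertices off c can be deleted without touching c or losing extremality.
When none remain, a bridge would have vertices of c on both sides, so all edges belong to c. -/
theorem IsExtremal.isTypeB {φ : GainFunction G} (h : φ.IsExtremal) {u : V} {c : G.Walk u u}
    (hc : c.IsCycle) : φ.IsTypeB c ∧ 4 ∣ c.length := by
  induction hn : G.edgeSet.ncard using Nat.strong_induction_on generalizing G u with
  | _ n ih =>
    have step : ∀ S : Set V, (φ.restr S).IsExtremal → G.restr S < G → (∀ x ∈ c.support, x ∈ S) →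
        φ.IsTypeB c ∧ 4 ∣ c.length := fun S hS hlt hsub => by
      have := ih _ (hn ▸ ncard_edgeSet_lt_of_lt hlt) hS
        (hc.transfer (Walk.mem_edgeSet_restr hsub)) rfl
      rw [Walk.length_transfer] at this
      exact ⟨this.1.of_transfer, this.2⟩
    by_cases hp : ∃ w, G.IsPendant w
    · obtain ⟨a, ha⟩ := hp
      obtain ⟨b, hb⟩ := Set.ncard_eq_one.1 ha
      have hab : G.Adj a b := by
        have : b ∈ G.neighborSet a := hb ▸ Set.mem_singleton b
        exact this
      refine step _ (h.restr_of_isPendant ha hab).1 (restr_lt_of_adj hab (by simp)) ?_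
      rintro x hx (rfl | rfl)
      · exact SimpleGraph.not_isCyclic_of_isPendant ha (isCyclic_of_mem_support hc hx)
      · exact h.not_isCyclic_of_isPendant ha hab (isCyclic_of_mem_support hc hx)
    push Not at hp
    by_cases hx : ∃ x, G.IsCyclic x ∧ x ∉ c.support
    · obtain ⟨x, hx, hxc⟩ := hx
      obtain ⟨d, hd⟩ := id hx
      refine step _ (h.restr_of_isCyclic hx).1 (restr_lt_of_adj (d.adj_snd hd.not_nil) (by simp)) ?_
      rintro y hy rfl
      exact hxc hy
    push Not at hx
    refine h.isTypeB_of_forall_mem_edges hc fun a b hab => ?_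
    by_cases hb : G.IsBridge s(a, b)
    · obtain ⟨x, hxb, hxc⟩ := exists_isCyclic_mem_branch hp hab hb
      obtain ⟨y, hyb, hyc⟩ := exists_isCyclic_mem_branch hp hab.symm (by rwa [Sym2.eq_swap])
      exact absurd (hx x hxc) (by
        intro hxs
        have h1 := reachable_deleteEdges_of_isCycle (hb.notMem_edges_of_isCycle hc) hxs (hx y hyc)
        have hyb : (G.deleteEdges {s(b, a)}).Reachable a y := hyb
        rw [Sym2.eq_swap] at hyb
        exact isBridge_iff.1 hb (hyb.trans (Reachable.trans hxb h1).symm))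
    · by_contra hne
      exact hb (h.cyclesCoincide.isBridge hc (hx a (isCyclic_of_not_isBridge hab hb)) hab hne)

/-- Each chosen vertex has a cycle that avoids the others, so it is still cyclic when its turn
comes. -/
theorem IsExtremal.restr_compl_finset {φ : GainFunction G} (h : φ.IsExtremal) (X : Finset V)
    (hX : ∀ x ∈ X, ∃ c : G.Walk x x, c.IsCycle ∧ ∀ y ∈ c.support, y ∈ X → y = x) :
    (φ.restr (X : Set V)ᶜ).IsExtremal ∧ (G.restr (X : Set V)ᶜ).adjRank = G.adjRank := by
  classical
  induction X using Finset.induction_on with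
  | empty =>
    rw [Finset.coe_empty, Set.compl_empty]
    exact ⟨h.restr_univ, by rw [SimpleGraph.restr_univ]⟩
  | @insert x X hx ih =>
    have ih := ih fun y hy => by
      obtain ⟨c, hc, hcX⟩ := hX y (by simp [hy])
      exact ⟨c, hc, fun t ht htX => hcX t ht (by simp [htX])⟩
    obtain ⟨c, hc, hcX⟩ := hX x (by simp)
    have hsub : ∀ y ∈ c.support, y ∈ (X : Set V)ᶜ := fun y hy hyX => by
      have := hcX y hy (Finset.mem_insert_of_mem hyX)
      exact hx (this ▸ hyX)
    have hcyc : (G.restr (X : Set V)ᶜ).IsCyclic x :=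
      ⟨_, hc.transfer (Walk.mem_edgeSet_restr hsub)⟩
    have e : ((insert x X : Finset V) : Set V)ᶜ = (X : Set V)ᶜ ∩ {x}ᶜ := by
      ext y; simp; tauto
    rw [e]
    have h1 := ih.1.restr_of_isCyclic hcyc
    refine ⟨h1.1.restr_inter, ?_⟩
    rw [← SimpleGraph.restr_restr, h1.2.1, ih.2]

theorem IsExtremal.not_isBridge_of_isCyclic {φ : GainFunction G} (h : φ.IsExtremal)
    (hp : ∀ v, ¬ G.IsPendant v) {u v : V} (hu : G.IsCyclic u) (huv : G.Adj u v) :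
    ¬ G.IsBridge s(u, v) := by
  classical
  intro hbuv
  -- The cyclic vertices from which a bridge leads back towards u. Each cycle meets X ∪ {u} at most
  -- once.
  set X : Finset V := Finset.univ.filter fun x =>
    G.IsCyclic x ∧ ∃ p, G.Adj p x ∧ G.IsBridge s(p, x) ∧ u ∈ G.branch x p with hXdef
  have hX : ∀ {x}, x ∈ X ↔ G.IsCyclic x ∧ ∃ p, G.Adj p x ∧ G.IsBridge s(p, x) ∧
      u ∈ G.branch x p := by simp [hXdef]
  have hY : ∀ x ∈ insert u X, ∃ c : G.Walk x x, c.IsCycle ∧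
      ∀ y ∈ c.support, y ∈ insert u X → y = x := by
    intro x hx
    rcases Finset.mem_insert.1 hx with rfl | hx
    · obtain ⟨c, hc⟩ := hu
      refine ⟨c, hc, fun y hy hyX => ?_⟩
      rcases Finset.mem_insert.1 hyX with rfl | hyX
      · rfl
      · obtain ⟨-, p, -, hb, hup⟩ := hX.1 hyX
        exact absurd hy (hb.notMem_branch_swap_of_isCycle hup hc c.start_mem_support)
    · obtain ⟨⟨c, hc⟩, p, hpx, hb, hup⟩ := hX.1 hx
      refine ⟨c, hc, fun y hy hyX => ?_⟩
      rcases Finset.mem_insert.1 hyX with rfl | hyX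
      · exact absurd c.start_mem_support (hb.notMem_branch_swap_of_isCycle hup hc hy)
      · obtain ⟨-, p', hpy, hb', hup'⟩ := hX.1 hyX
        exact eq_of_mem_support_of_isBridge hpy hb' hb hup' hup hc hy c.start_mem_support
  have hrank := (h.restr_compl_finset _ hY).2
  rw [adjRank_restr, ← rank_trivialGain] at hrank
  -- A kernel vector of the ordinary adjacency matrix with value 1 at u and 0 on X.
  obtain ⟨z, hz, hzu, hzX⟩ := Matrix.exists_mulVec_eq_zero_of_rank_restr hrank
    (x := u) (by simp)
  have hzX : ∀ x ∈ X, z x = 0 := fun x hx => hzX x (by simp [hx]) fun e => by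
    subst e
    obtain ⟨⟨c, hc⟩, p, -, hb, hup⟩ := hX.1 hx
    exact hb.notMem_branch_swap_of_isCycle hup hc c.start_mem_support c.start_mem_support
  -- Vanishing propagates from the smallest branches towards u: if z vanishes across all further
  -- bridges, the equations at v and on its cycle give z v = z p = 0.
  have claim : ∀ n p v, (G.branch p v).ncard = n → G.Adj p v → G.IsBridge s(p, v) →
      u ∈ G.branch v p → z v = 0 ∧ z p = 0 := by
    intro n
    induction n using Nat.strong_induction_on with
    | _ n ih =>
      intro p v hn hpv hb hup
      have child : ∀ c w, (G.deleteEdges {s(p, v)}).Reachable v c →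
          (G.deleteEdges {s(c, w)}).Reachable v c → G.Adj c w → G.IsBridge s(c, w) →
          ¬ (c = v ∧ w = p) → z w = 0 ∧ z c = 0 := fun c w h1 h2 hcw hbw hne =>
        ih _ (hn ▸ Set.ncard_lt_ncard (branch_ssubset hb h1 h2 hcw hbw hne) (Set.toFinite _)) c w
          rfl hcw hbw (mem_branch_of_child hpv hb h1 h2 hne hup)
      by_cases hv : G.IsCyclic v
      · have hzv : z v = 0 := hzX v (hX.2 ⟨hv, p, hpv, hb, hup⟩)
        refine ⟨hzv, ?_⟩
        obtain ⟨c, hc⟩ := hv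
        have hpc : s(v, p) ∉ c.edges := by
          rw [Sym2.eq_swap]; exact hb.notMem_edges_of_isCycle hc
        have hz0 : ∀ x ∈ c.support, ∀ w, G.Adj x w → s(x, w) ∉ c.edges → ¬ (x = v ∧ w = p) →
            z w = 0 := fun x hx w hxw hne hne' =>
          (child x w (reachable_deleteEdges_of_isCycle (hb.notMem_edges_of_isCycle hc)
            c.start_mem_support hx) (reachable_deleteEdges_of_isCycle hne c.start_mem_support hx)
            hxw (h.cyclesCoincide.isBridge hc hx hxw hne) hne').1
        have hint : (trivialGain G).InteriorKernel c z := fun i hi =>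
          ⟨congrFun hz _, fun w hw hne => hz0 _ (c.getVert_mem_support _) w hw hne fun e => by
            have := (hc.getVert_endpoint_iff hi.le).1 e.1
            omega⟩
        -- The equation at v reads z p + z `c.snd` + z `c.penultimate` = 0, and the last two terms
        -- cancel because 4 divides the length.
        have hsum := hint.snd_add_penultimate hc (h.isTypeB hc).2
        have heq : ((trivialGain G).adjMatrix.mulVec z) v = 0 := congrFun hz v
        rw [mulVec_base_of_adj _ hc hpc fun w hw hne hwp =>
          hz0 v c.start_mem_support w hw hne (by tauto),
          adjMatrix_trivialGain_of_adj hpv.symm,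
          adjMatrix_trivialGain_of_adj (c.adj_snd hc.not_nil),
          adjMatrix_trivialGain_of_adj (c.adj_penultimate hc.not_nil).symm] at heq
        linear_combination heq - hsum
      · have hch : ∀ w, G.Adj v w → w ≠ p → z w = 0 ∧ z v = 0 := fun w hw hwp =>
          child v w (Reachable.refl _) (Reachable.refl _) hw (isBridge_of_not_isCyclic hw hv)
            (by tauto)
        obtain ⟨w, hvw, hwp⟩ := not_isPendant_exists_ne hpv.symm (hp v)
        refine ⟨(hch w hvw hwp).2, ?_⟩
        have heq : ((trivialGain G).adjMatrix.mulVec z) v = 0 := congrFun hz v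
        rw [mulVec_eq_sum _ {p} fun w hw hwp => (hch w hw (by simpa using hwp)).1,
          Finset.sum_singleton, adjMatrix_trivialGain_of_adj hpv.symm, one_mul] at heq
        exact heq
  have := (claim _ u v rfl huv hbuv (Reachable.refl _)).2
  rw [hzu] at this
  exact one_ne_zero this

/-- A bridge with non-cyclic far end continues into a smaller branch, so it suffices to exclude
bridges with a cyclic end. -/
theorem IsExtremal.not_isBridge {φ : GainFunction G} (h : φ.IsExtremal)
    (hp : ∀ v, ¬ G.IsPendant v) {p v : V} (hpv : G.Adj p v) : ¬ G.IsBridge s(p, v) := by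
  intro hb
  induction hn : (G.branch p v).ncard using Nat.strong_induction_on generalizing p v with
  | _ n ih =>
    by_cases hv : G.IsCyclic v
    · exact h.not_isBridge_of_isCyclic hp hv hpv.symm (by rwa [Sym2.eq_swap])
    obtain ⟨w, hvw, hwp⟩ := not_isPendant_exists_ne hpv.symm (hp v)
    have hbw := isBridge_of_not_isCyclic hvw hv
    exact ih _ (hn ▸ Set.ncard_lt_ncard (branch_ssubset hb (Reachable.refl v) (Reachable.refl v)
      hvw hbw (by tauto)) (Set.toFinite _)) hvw hbw rfl

end GainFunction

/-! ### Induced subgraphs and bridgeless components. -/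

namespace SimpleGraph

variable {V : Type*} {G H : SimpleGraph V}

theorem isPendant_induce_iff {S : Set V} (u : S) :
    (G.induce S).IsPendant u ↔ (G.restr S).IsPendant u := by
  have : (G.restr S).neighborSet u = Subtype.val '' (G.induce S).neighborSet u := by
    ext x
    constructor
    · intro h
      exact ⟨⟨x, h.2.1⟩, h.2.2, rfl⟩
    · rintro ⟨y, hy, rfl⟩
      exact ⟨u.2, y.2, hy⟩
  rw [IsPendant, IsPendant, this, Set.ncard_image_of_injective _ Subtype.val_injective]

theorem not_isBridge_induce {S : Set V} (h : ∀ a b, (G.restr S).Adj a b →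
    ¬ (G.restr S).IsBridge s(a, b)) {a b : S} (hab : (G.induce S).Adj a b) :
    ¬ (G.induce S).IsBridge s(a, b) := by
  have hb := h a b ⟨a.2, b.2, hab⟩
  rw [isBridge_iff, not_not] at hb ⊢
  have key : ∃ hb : (b : V) ∈ S,
      ((G.induce S).deleteEdges {s(a, b)}).Reachable a ⟨b, hb⟩ := by
    refine forall_of_reachable
      (P := fun y => ∃ hy : y ∈ S, ((G.induce S).deleteEdges {s(a, b)}).Reachable a ⟨y, hy⟩)
      hb ⟨a.2, Reachable.refl _⟩ ?_
    rintro x y ⟨hx, hax⟩ hxy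
    rw [deleteEdges_adj] at hxy
    refine ⟨hxy.1.2.1, hax.trans (Adj.reachable ?_)⟩
    rw [deleteEdges_adj]
    refine ⟨hxy.1.2.2, fun e => hxy.2 ?_⟩
    have := congrArg (Sym2.map Subtype.val) (Set.mem_singleton_iff.1 e)
    simpa using this
  exact key.2

theorem CyclesCoincide.induce (hG : G.CyclesCoincide) (S : Set V) :
    (G.induce S).CyclesCoincide := by
  intro u v c d hc hd x hx hx' e he
  let f := (Embedding.induce (G := G) S).toHom
  have hf : Function.Injective f := Subtype.val_injective
  have := hG (c.map f) (d.map f) (hc.map hf) (hd.map hf) (f x)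
    (by rw [Walk.support_map]; exact List.mem_map_of_mem hx)
    (by rw [Walk.support_map]; exact List.mem_map_of_mem hx')
    (Sym2.map f e) (by rw [Walk.edges_map]; exact List.mem_map_of_mem he)
  rw [Walk.edges_map] at this
  exact (List.mem_map_of_injective (Sym2.map.injective hf)).1 this

/-- Any edge lies on a cycle. An edge leaving that cycle would be a bridge, so the cycle fills its
component. -/
theorem CyclesCoincide.isCycleComponent_or (hG : G.CyclesCoincide)
    (hb : ∀ a b, G.Adj a b → ¬ G.IsBridge s(a, b)) (K : G.ConnectedComponent) :
    K.IsCycleComponent ∨ ∃ v, K.supp = {v} := by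
  induction K using ConnectedComponent.ind with
  | h v =>
    by_cases hv : ∃ w, G.Adj v w
    · left
      obtain ⟨w, hvw⟩ := hv
      obtain ⟨c, hc⟩ := isCyclic_of_not_isBridge hvw (hb v w hvw)
      have hcl : ∀ x ∈ c.support, ∀ y, G.Adj x y → s(x, y) ∈ c.edges := fun x hx y hxy => by
        by_contra hne
        exact hb x y hxy (hG.isBridge hc hx hxy hne)
      have hsupp : ∀ x, x ∈ (G.connectedComponentMk v).supp ↔ x ∈ c.support := fun x => by
        rw [ConnectedComponent.mem_supp_iff, ConnectedComponent.eq]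
        constructor
        · intro h
          exact forall_of_reachable (P := (· ∈ c.support)) h.symm c.start_mem_support
            fun a b ha hab => c.snd_mem_support_of_mem_edges (hcl a ha b hab)
        · intro h
          classical exact ⟨(c.takeUntil x h).reverse⟩
      refine ⟨v, c, hc, ?_⟩
      refine Subgraph.ext (Set.ext fun x => ?_) (funext₂ fun a b => propext ?_)
      · rw [Walk.mem_verts_toSubgraph]; exact (hsupp x).symm
      · rw [Walk.adj_toSubgraph_iff_mem_edges]
        constructor
        · intro h
          exact ⟨(hsupp a).2 (c.fst_mem_support_of_mem_edges h),
            (hsupp b).2 (c.snd_mem_support_of_mem_edges h), c.adj_of_mem_edges h⟩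
        · rintro ⟨ha, -, hab⟩
          exact hcl a ((hsupp a).1 ha) b hab
    · right
      push Not at hv
      refine ⟨v, Set.eq_singleton_iff_unique_mem.2 ⟨rfl, fun x hx => ?_⟩⟩
      rw [ConnectedComponent.mem_supp_iff, ConnectedComponent.eq] at hx
      exact forall_of_reachable (P := (· = v)) hx.symm rfl
        fun a b ha hab => absurd hab (ha ▸ hv b)

theorem ConnectedComponent.IsCycleComponent.exists_isCycle {K : G.ConnectedComponent}
    (hK : K.IsCycleComponent) : ∃ (u : V) (c : G.Walk u u), c.IsCycle ∧
      (∀ x, x ∈ c.support ↔ G.connectedComponentMk x = K) ∧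
      ∀ x ∈ c.support, ∀ w, G.Adj x w → s(x, w) ∈ c.edges := by
  obtain ⟨u, c, hc, he⟩ := hK
  have hs : ∀ x, x ∈ c.support ↔ G.connectedComponentMk x = K := fun x => by
    rw [← Walk.mem_verts_toSubgraph, he]; rfl
  refine ⟨u, c, hc, hs, fun x hx w hxw => ?_⟩
  rw [← Walk.adj_toSubgraph_iff_mem_edges, he]
  have hxK := (hs x).1 hx
  exact ⟨hxK, (ConnectedComponent.sound hxw.reachable).symm.trans hxK, hxw⟩

end SimpleGraph

/-! ### Ranks on disjoint unions of cycles, and crucial subgraphs. -/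

namespace GainFunction

variable {V : Type*} {G H : SimpleGraph V}

/-- The restriction of a gain function to an induced subgraph. -/
noncomputable def induce (φ : GainFunction G) (S : Set V) : GainFunction (G.induce S) :=
  ⟨fun d => φ.gain ⟨(d.fst, d.snd), d.adj⟩, fun d => φ.gain_symm ⟨(d.fst, d.snd), d.adj⟩⟩

theorem adjMatrix_induce (φ : GainFunction G) (S : Set V) :
    (φ.induce S).adjMatrix = φ.adjMatrix.submatrix Subtype.val Subtype.val := by
  ext u v
  rw [Matrix.submatrix_apply]
  by_cases h : (G.induce S).Adj u v
  · rw [adjMatrix_of_adj _ h, adjMatrix_of_adj φ (u := u) (v := v) h]; rfl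
  · rw [adjMatrix_of_not_adj _ h, adjMatrix_of_not_adj φ (u := u) (v := v) h]

theorem walkGain_map_induce (φ : GainFunction G) {S : Set V} {u v : S}
    (c : (G.induce S).Walk u v) :
    φ.walkGain (c.map (Embedding.induce (G := G) S).toHom) = (φ.induce S).walkGain c := by
  induction c with
  | nil => simp [walkGain]
  | cons h p ih =>
    have e : (φ.induce S).walkGain (Walk.cons h p) =
      (φ.induce S).gain ⟨(_, _), h⟩ * (φ.induce S).walkGain p := List.prod_cons
    rw [e, ← ih]
    exact List.prod_cons

theorem isTypeB_induce {φ : GainFunction G}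
    (h : ∀ (u : V) (c : G.Walk u u), c.IsCycle → φ.IsTypeB c ∧ 4 ∣ c.length) {S : Set V}
    (u : S) (c : (G.induce S).Walk u u) (hc : c.IsCycle) :
    (φ.induce S).IsTypeB c ∧ 4 ∣ c.length := by
  have := h _ _ (hc.map (f := (Embedding.induce (G := G) S).toHom) Subtype.val_injective)
  unfold IsTypeB at *
  rwa [walkGain_map_induce, Walk.length_map] at this

variable [Fintype V]

theorem rank_induce (φ : GainFunction G) (S : Set V) [Fintype S] :
    (φ.induce S).rank = (φ.restr S).rank := by
  rw [rank_restr_eq, rank, adjMatrix_induce, Matrix.rank_submatrix_val]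

theorem adjRank_induce (G : SimpleGraph V) (S : Set V) [Fintype S] :
    (G.induce S).adjRank = (G.restr S).adjRank := by
  rw [← rank_trivialGain, ← rank_trivialGain]
  exact rank_induce (trivialGain G) S

/-- Both nullities are computed: isolated vertices contribute 1 to each, and a cycle contributes 0
for Φ and 2 for G. -/
theorem rank_eq_of_isDisjointUnionOfCycles (φ : GainFunction G) {k : ℤ}
    (hU : G.IsDisjointUnionOfCycles k)
    (hB : ∀ (u : V) (c : G.Walk u u), c.IsCycle → φ.IsTypeB c ∧ 4 ∣ c.length) :
    (φ.rank : ℤ) = G.adjRank + 2 * k := by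
  classical
  obtain ⟨hcomp, hk⟩ := hU
  set Ks : Finset G.ConnectedComponent :=
    Finset.univ.filter fun K => K.IsCycleComponent with hKs
  have hmK : ∀ {K}, K ∈ Ks ↔ K.IsCycleComponent := by simp [hKs]
  have hkc : (Ks.card : ℤ) = k := by
    rw [← hk, ← Set.ncard_coe_finset]; congr; ext K; simp [hmK]
  have hex : ∀ K : G.ConnectedComponent, ∃ (u : V) (c : G.Walk u u), K ∈ Ks → c.IsCycle ∧
      (∀ x, x ∈ c.support ↔ G.connectedComponentMk x = K) ∧
      ∀ x ∈ c.support, ∀ w, G.Adj x w → s(x, w) ∈ c.edges := fun K => by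
    by_cases hK : K ∈ Ks
    · obtain ⟨u, c, h⟩ := (hmK.1 hK).exists_isCycle
      exact ⟨u, c, fun _ => h⟩
    · obtain ⟨u, -⟩ := K.exists_rep
      exact ⟨u, Walk.nil, fun h => absurd h hK⟩
  choose b c' hc' using hex
  have hc := fun K hK => (hc' K hK).1
  have hs := fun K hK => (hc' K hK).2.1
  have hcl := fun K hK => (hc' K hK).2.2
  set I : Finset V := Finset.univ.filter fun x => ∀ y, ¬ G.Adj x y with hI
  have hmI : ∀ {x}, x ∈ I ↔ ∀ y, ¬ G.Adj x y := by simp [hI]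
  have hcover : ∀ x, x ∉ I → ∃ K ∈ Ks, x ∈ (c' K).support := fun x hx => by
    rw [hmI] at hx
    push Not at hx
    obtain ⟨y, hxy⟩ := hx
    rcases hcomp (G.connectedComponentMk x) with h | ⟨v, hv⟩
    · exact ⟨_, hmK.2 h, (hs _ (hmK.2 h) x).2 rfl⟩
    · have h1 : x ∈ (G.connectedComponentMk x).supp := rfl
      have h2 : y ∈ (G.connectedComponentMk x).supp :=
        (ConnectedComponent.sound hxy.reachable).symm
      rw [hv] at h1 h2
      exact absurd (h1.trans h2.symm) hxy.ne
  have hnI : ∀ K ∈ Ks, ∀ x ∈ (c' K).support, x ∉ I := fun K hK x hx hxI => by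
    obtain ⟨y, hy⟩ := (hc K hK).exists_mem_edges hx
    exact hmI.1 hxI y ((c' K).adj_of_mem_edges hy)
  have hker : ∀ (ψ : GainFunction G) (z : V → ℂ), ψ.adjMatrix.mulVec z = 0 → ∀ K ∈ Ks,
      ψ.CycleKernel (c' K) z := fun ψ z hz K hK x hx =>
    ⟨congrFun hz x, fun w hw hn => absurd (hcl K hK x hx w hw) hn⟩
  have hφ1 : φ.rank + I.card ≤ Fintype.card V :=
    Matrix.rank_add_card_le _ _ fun t ht => ⟨Pi.single t 1,
      mulVec_single_eq_zero φ fun x hx => hmI.1 ht x hx.symm, by simp, fun s _ h => by simp [h]⟩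
  have hφ2 : Fintype.card V ≤ φ.rank + I.card :=
    Matrix.card_le_rank_add_card _ _ fun z hz h0 => funext fun x => by
      by_cases hx : x ∈ I
      · exact h0 x hx
      obtain ⟨K, hK, hxK⟩ := hcover x hx
      obtain ⟨⟨he, hg⟩, -⟩ := hB _ _ (hc K hK)
      exact (hker φ z hz K hK).eq_zero_of_walkGain_ne (hc K hK) he hg x hxK
  -- Coordinates for the kernel of G: the isolated vertices and two consecutive vertices on each
  -- cycle.
  set T : Finset V := I ∪ (Ks.image b ∪ Ks.image fun K => (c' K).snd) with hT
  have hbs : ∀ K, b K ∈ (c' K).support := fun K => (c' K).start_mem_support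
  have hss : ∀ K, (c' K).snd ∈ (c' K).support := fun K => (c' K).getVert_mem_support 1
  have huniq : ∀ K ∈ Ks, ∀ K' ∈ Ks, ∀ x ∈ (c' K).support, x ∈ (c' K').support → K = K' :=
    fun K hK K' hK' x hx hx' => ((hs K hK x).1 hx).symm.trans ((hs K' hK' x).1 hx')
  have hTc : T.card = I.card + 2 * Ks.card := by
    rw [hT, Finset.card_union_of_disjoint, Finset.card_union_of_disjoint,
      Finset.card_image_of_injOn, Finset.card_image_of_injOn]
    · ring
    · intro K hK K' hK' e
      have e : (c' K).snd = (c' K').snd := e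
      have hsK : (c' K).snd ∈ (c' K').support := by rw [e]; exact hss K'
      exact huniq K hK K' hK' _ (hss K) hsK
    · intro K hK K' hK' e
      have hbK : b K ∈ (c' K').support := by rw [e]; exact hbs K'
      exact huniq K hK K' hK' _ (hbs K) hbK
    · rw [Finset.disjoint_left]
      intro x hx hx'
      obtain ⟨K, hK, rfl⟩ := Finset.mem_image.1 hx
      obtain ⟨K', hK', e⟩ := Finset.mem_image.1 hx'
      have e : (c' K').snd = b K := e
      have hbK : b K ∈ (c' K').support := by rw [← e]; exact hss K'
      obtain rfl := huniq K hK K' hK' _ (hbs K) hbK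
      exact ((c' K).adj_snd (hc K hK).not_nil).ne e.symm
    · rw [Finset.disjoint_right]
      intro x hx
      rcases Finset.mem_union.1 hx with hx | hx
      · obtain ⟨K, hK, rfl⟩ := Finset.mem_image.1 hx
        exact hnI K hK _ (hbs K)
      · obtain ⟨K, hK, rfl⟩ := Finset.mem_image.1 hx
        exact hnI K hK _ (hss K)
  have hTK : ∀ s ∈ T, ∀ K ∈ Ks, s ∈ (c' K).support → s = b K ∨ s = (c' K).snd := by
    intro s hs K hK hsK
    rw [hT, Finset.mem_union, Finset.mem_union] at hs
    rcases hs with hs | hs | hs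
    · exact absurd hs (hnI K hK s hsK)
    · obtain ⟨K', hK', rfl⟩ := Finset.mem_image.1 hs
      exact Or.inl (by rw [huniq K' hK' K hK _ (hbs K') hsK])
    · obtain ⟨K', hK', rfl⟩ := Finset.mem_image.1 hs
      exact Or.inr (by rw [huniq K' hK' K hK _ (hss K') hsK])
  have hG1 : Fintype.card V ≤ (trivialGain G).rank + T.card :=
    Matrix.card_le_rank_add_card _ _ fun z hz h0 => funext fun x => by
      by_cases hx : x ∈ I
      · exact h0 x (by rw [hT]; exact Finset.mem_union_left _ hx)
      obtain ⟨K, hK, hxK⟩ := hcover x hx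
      refine (hker _ z hz K hK).interiorKernel.eq_zero (hc K hK) (h0 _ ?_) (h0 _ ?_) x hxK
      · exact Finset.mem_union_right _ (Finset.mem_union_left _ (Finset.mem_image_of_mem b hK))
      · exact Finset.mem_union_right _ (Finset.mem_union_right _
          (Finset.mem_image_of_mem (fun K => (c' K).snd) hK))
  have hG2 : (trivialGain G).rank + T.card ≤ Fintype.card V := by
    refine Matrix.rank_add_card_le _ _ fun t ht => ?_
    by_cases htI : t ∈ I
    · exact ⟨Pi.single t 1, mulVec_single_eq_zero _ fun x hx => hmI.1 htI x hx.symm, by simp,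
        fun s _ h => by simp [h]⟩
    obtain ⟨K, hK, htK⟩ := hcover t htI
    obtain ⟨⟨he, -⟩, m, hm⟩ := hB _ _ (hc K hK)
    have hg : (trivialGain G).walkGain (c' K) = (-1) ^ ((c' K).length / 2) := by
      rw [walkGain_trivialGain, hm, show 4 * m / 2 = 2 * m by omega, pow_mul]; norm_num
    have hex := exists_mulVec_eq_zero_of_walkGain_eq (hc K hK) (hcl K hK) he hg
    rcases hTK t ht K hK htK with rfl | rfl
    · obtain ⟨z, hz, h1, h2, h3⟩ := hex 1 0
      refine ⟨z, hz, h1, fun s hs hne => ?_⟩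
      by_cases hsK : s ∈ (c' K).support
      · rw [(hTK s hs K hK hsK).resolve_left hne, h2]
      · exact h3 s hsK
    · obtain ⟨z, hz, h1, h2, h3⟩ := hex 0 1
      refine ⟨z, hz, h2, fun s hs hne => ?_⟩
      by_cases hsK : s ∈ (c' K).support
      · rw [(hTK s hs K hK hsK).resolve_right hne, h1]
      · exact h3 s hsK
  rw [← rank_trivialGain]
  omega

theorem IsExtremal.exists_isCrucial {φ : GainFunction G} {S : Set V}
    (h : (φ.restr S).IsExtremal) : ∃ S', Relation.ReflTransGen G.DeltaStep S S' ∧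
      (∀ v : S', ¬ (G.induce S').IsPendant v) ∧ (φ.restr S').IsExtremal ∧
      (G.restr S').cycleDim = (G.restr S).cycleDim := by
  induction hn : S.ncard using Nat.strong_induction_on generalizing S with
  | _ n ih =>
    by_cases hp : ∃ u : S, (G.induce S).IsPendant u
    · obtain ⟨u, hu⟩ := hp
      obtain ⟨v, hv⟩ := Set.ncard_eq_one.1 hu
      have huv : (G.induce S).Adj u v := by
        have : v ∈ (G.induce S).neighborSet u := hv ▸ Set.mem_singleton v
        exact this
      have h1 := h.restr_of_isPendant ((isPendant_induce_iff u).1 hu) ⟨u.2, v.2, huv⟩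
      have h2 := h1.1.restr_inter
      rw [← Set.sdiff_eq] at h2
      have hlt : (S \ {(u : V), (v : V)}).ncard < n := by
        rw [← hn]
        exact Set.ncard_lt_ncard (Set.ssubset_iff_exists.2 ⟨Set.sdiff_subset, u, u.2,
          fun hu => hu.2 (by simp)⟩) (Set.toFinite _)
      obtain ⟨S', hS', hp', hE', hθ⟩ := ih _ hlt h2 rfl
      refine ⟨S', Relation.ReflTransGen.head ⟨u, v, hu, huv, rfl⟩ hS', hp', hE', ?_⟩
      rw [hθ, ← h1.2, SimpleGraph.restr_restr, Set.sdiff_eq]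
    · push Not at hp
      exact ⟨S, Relation.ReflTransGen.refl, hp, h, rfl⟩

theorem rank_sub_adjRank_of_reflTransGen (φ : GainFunction G) {S S' : Set V}
    (h : Relation.ReflTransGen G.DeltaStep S S') :
    ((φ.restr S').rank : ℤ) - (G.restr S').adjRank =
      (φ.restr S).rank - (G.restr S).adjRank := by
  induction h with
  | refl => rfl
  | @tail T T' _ hT ih =>
    rw [← ih]
    obtain ⟨u, v, hu, huv, rfl⟩ := hT
    have hu' := (isPendant_induce_iff u).1 hu
    have huv' : (G.restr T).Adj u v := ⟨u.2, v.2, huv⟩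
    have h1 := (φ.restr T).rank_eq_of_isPendant hu' huv'
    have h2 := adjRank_eq_of_isPendant hu' huv'
    rw [SimpleGraph.restr_restr, ← Set.sdiff_eq] at h2
    rw [rank_restr_eq (φ.restr T), adjMatrix_restr, Matrix.restr_restr, ← rank_restr_eq,
      ← Set.sdiff_eq] at h1
    omega

end GainFunction

/-! ### The characterization of equality. -/

theorem theorem4p9 {V : Type*} [Fintype V] (G : SimpleGraph V) (φ : GainFunction G) :
    (φ.rank : ℤ) = (G.adjRank : ℤ) + 2 * G.cycleDim ↔
      G.CyclesVertexDisjoint ∧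
      (∀ (u : V) (c : G.Walk u u), c.IsCycle → φ.IsTypeB c ∧ c.length ≡ 0 [MOD 4]) ∧
      (∃ S : Set V, G.IsCrucial S ∧ (G.induce S).IsDisjointUnionOfCycles G.cycleDim) := by
  classical
  simp only [Nat.modEq_zero_iff_dvd]
  constructor
  · intro h
    have h : φ.IsExtremal := h
    have hB : ∀ (u : V) (c : G.Walk u u), c.IsCycle → φ.IsTypeB c ∧ 4 ∣ c.length :=
      fun u c hc => h.isTypeB hc
    refine ⟨h.cyclesCoincide.cyclesVertexDisjoint, hB, ?_⟩
    obtain ⟨S, hS, hp, hE, hθ⟩ := h.restr_univ.exists_isCrucial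
    rw [SimpleGraph.restr_univ] at hθ
    have hp' : ∀ v, ¬ (G.restr S).IsPendant v := fun v hv => by
      obtain ⟨w, hw⟩ := Set.nonempty_of_ncard_ne_zero (hv ▸ one_ne_zero)
      have hw : (G.restr S).Adj v w := hw
      exact hp ⟨v, hw.1⟩ ((isPendant_induce_iff ⟨v, hw.1⟩).2 hv)
    have hcomp := (h.cyclesCoincide.induce S).isCycleComponent_or fun a b hab =>
      not_isBridge_induce (fun a b hab => hE.not_isBridge hp' hab) hab
    -- Here k is the number of cycle components itself; extremality of the restriction to S, with θ
    -- unchanged, then gives k = θ(G).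
    have hrank := (φ.induce S).rank_eq_of_isDisjointUnionOfCycles ⟨hcomp, rfl⟩
      (GainFunction.isTypeB_induce hB)
    rw [GainFunction.rank_induce, GainFunction.adjRank_induce] at hrank
    refine ⟨S, ⟨hS, hp⟩, hcomp, ?_⟩
    unfold GainFunction.IsExtremal at hE
    omega
  · rintro ⟨-, hB, S, ⟨hS, -⟩, hU⟩
    have hrank := (φ.induce S).rank_eq_of_isDisjointUnionOfCycles hU
      (GainFunction.isTypeB_induce hB)
    have h1 := φ.rank_sub_adjRank_of_reflTransGen hS
    have h2 : (φ.restr Set.univ).rank = φ.rank := by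
      rw [GainFunction.rank_restr_eq]
      exact congrArg Matrix.rank (by ext; simp [Matrix.restr])
    rw [GainFunction.rank_induce, GainFunction.adjRank_induce] at hrank
    rw [h2, SimpleGraph.restr_univ] at h1
    omega
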